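/- Let $D=\mathbb{C}\setminus\big((-\infty,0]\cup[1,\infty)\big)$. For $t\in D$ let $K(t)=\int_0^{\pi/2}(1-t\sin^2\varphi)^{-1/2}d\varphi$ be the complete elliptic integral of the first kind of parameter $t=k^2$, $\tau=\tau(t)=iK(1-t)/K(t)$, $q=e^{i\pi\tau}$ (with $q^a=e^{i\pi\tau a}$), and let $\theta_i(v|\tau)$ be the standard theta functions with quasi-periods $\pi,\pi\tau$. For $x,y\in\mathbb{C}$ let $$q_0(t)=t\,\frac{\mathrm{cn}^2(z,t)}{\mathrm{dn}^2(z,t)},\qquad z=\frac{2K(t)}{\pi}(x+\tau y),$$ be the Picard solution of the sixth Painlevé equation with $\alpha=\beta=\gamma=0$, $\delta=\tfrac12$. For $b=(b_1,b_2,b_3,b_4)$ put $\kappa_0=b_1+b_2$, $\kappa_1=b_1-b_2$, $\kappa_\infty=b_3-b_4$, $\theta=b_3+b_4+1$, $\kappa=\tfrac14(\kappa_0+\kappa_1+\theta-1)^2-\tfrac14\kappa_\infty^2$, and $$H(t;q,p;b)=\frac{1}{t(t-1)}\Big[q(q-1)(q-t)p^2-\{\kappa_0(q-1)(q-t)+\kappa_1q(q-t)+(\theta-1)q(q-1)\}p+\kappa(q-t)\Big].$$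 To a Hamiltonian $H(t)$ with parameters $b$ belongs the auxiliary function $h=t(t-1)H+e_2(b_1,b_3,b_4)\,t-\tfrac12e_2(b_1,b_2,b_3,b_4)$, where $e_2$ is the second elementary symmetric function. The parallel shift $l_3$ sends $b$ to $b^+=(b_1,b_2,b_3+1,b_4)$ and $h$ to the auxiliary function $h_+=h-q(q-1)p+(b_1+b_4)q-\tfrac12(b_1+b_2+b_4)$ with parameters $b^+$. Take $b=(0,0,-\tfrac12,-\tfrac12)$ and $q=q_0(t)$, let $p=p_0(t)$ be determined by $dq_0/dt=\partial H/\partial p$, let $h_0$ be the auxiliary function of $H_0(t)=H(t;q_0,p_0;b)$, let $h_1=(h_0)_+$, and let $H_1(t)$ be the Hamiltonian with auxiliary function $h_1$ and parameters $b^+=(0,0,\tfrac12,-\tfrac12)$. **Theorem.** Let $x,y\in\mathbb{C}$ and let $U$ be a connected open set of points $t\in D$ at which $q_0(t)\notin\{0,1,t,\infty\}$, i.e. $\theta_i(x+\tau y|\tau)\ne0$ for $i=1,2,3,4$. The tau-functions $\mathrm{T}_1(t)=\exp\{\int H_1(t)\,dt\}$ on $U$, that is, the zero-free functions $\mathrm{T}_1$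 on $U$ with $\frac{d}{dt}\log\mathrm{T}_1=H_1$, are exactly the functions $$\mathrm{T}_1(t)=c_1\,q^{y^2/\pi^2}(1-t)^{1/4}\,\frac{\theta_3(x+\tau y|\tau)}{\theta_4(0|\tau)},$$ where $c_1=c_1(x,y)\neq0$ is an arbitrary constant of integration (independent of $t$) and $(1-t)^{1/4}$ is the principal branch. -/

import Mathlib

open Complex

namespace PicardVI

noncomputable section

/-! ### Theta functions with quasi-periods `π` and `πτ` (Whittaker–Watson normalisation) -/

/-- `θ₄(v|τ) = ∑_{n ∈ ℤ} (-1)ⁿ q^{n²} e^{2niv}` with `q = e^{iπτ}`.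
Mathlib's `jacobiTheta₂ z τ` is `∑_{n ∈ ℤ} exp (2πinz + πin²τ)`. -/
def theta4 (v τ : ℂ) : ℂ := jacobiTheta₂ (v / Real.pi + 1 / 2) τ

/-- `θ₃(v|τ) = ∑_{n ∈ ℤ} q^{n²} e^{2niv}`. -/
def theta3 (v τ : ℂ) : ℂ := jacobiTheta₂ (v / Real.pi) τ

/-- `θ₂(v|τ) = ∑_{n ∈ ℤ} q^{(n+1/2)²} e^{(2n+1)iv}
= q^{1/4} e^{iv} θ₃(v + πτ/2|τ)`, where `q^{1/4} = e^{iπτ/4}`. -/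
def theta2 (v τ : ℂ) : ℂ :=
  exp (I * Real.pi * τ / 4 + I * v) * theta3 (v + Real.pi * τ / 2) τ

/-- `θ₁(v|τ) = 2 ∑_{n ≥ 0} (-1)ⁿ q^{(n+1/2)²} sin ((2n+1)v)
= -i q^{1/4} e^{iv} θ₄(v + πτ/2|τ)`. -/
def theta1 (v τ : ℂ) : ℂ :=
  -I * exp (I * Real.pi * τ / 4 + I * v) * theta4 (v + Real.pi * τ / 2) τ

/-! ### The independent variable, complete elliptic integrals and the modular parameter -/

/-- The plane cut along `(-∞, 0]` and `[1, ∞)`, on which the principal branches of `K(t)`,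
`K(1-t)` and of `t^a`, `(1-t)^a` are all holomorphic. -/
def cutPlane : Set ℂ := {t | t ∈ slitPlane ∧ 1 - t ∈ slitPlane}

/-- The complete elliptic integral of the first kind of the parameter `t = k²`,
`K(t) = ∫₀^{π/2} dφ / √(1 - t sin² φ) = (π/2) ₂F₁(1/2, 1/2; 1; t)`, for `t ∉ [1, ∞)`. -/
def ellK (t : ℂ) : ℂ :=
  ∫ φ in (0 : ℝ)..(Real.pi / 2), (1 - t * ((Real.sin φ : ℝ) : ℂ) ^ 2) ^ (-(1 / 2) : ℂ)

/-- `τ(t) = i K'(t) / K(t)`, `K'(t) = K(1-t)`. -/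
def tauOf (t : ℂ) : ℂ := I * ellK (1 - t) / ellK t

/-- The power `q^a` of the nome `q = e^{iπτ(t)}`, i.e. `e^{iπτ(t)a}`. -/
def nomePow (t a : ℂ) : ℂ := exp (I * Real.pi * tauOf t * a)

/-! ### Jacobi elliptic functions of argument `u` and parameter `t`

`v = πu/(2K(t))`, `k^{1/2} = θ₂(0|τ)/θ₃(0|τ)`, `k'^{1/2} = θ₄(0|τ)/θ₃(0|τ)`. -/

/-- `k^{1/2}`. -/
def sqrtK (t : ℂ) : ℂ := theta2 0 (tauOf t) / theta3 0 (tauOf t)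

/-- `k'^{1/2}`. -/
def sqrtK' (t : ℂ) : ℂ := theta4 0 (tauOf t) / theta3 0 (tauOf t)

/-- `cn(u, t)`. -/
def jacobiCn (u t : ℂ) : ℂ :=
  sqrtK' t / sqrtK t *
    (theta2 (Real.pi * u / (2 * ellK t)) (tauOf t) /
      theta4 (Real.pi * u / (2 * ellK t)) (tauOf t))

/-- `dn(u, t)`. -/
def jacobiDn (u t : ℂ) : ℂ :=
  sqrtK' t *
    (theta3 (Real.pi * u / (2 * ellK t)) (tauOf t) /
      theta4 (Real.pi * u / (2 * ellK t)) (tauOf t))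

/-! ### The Hamiltonian of Painlevé VI -/

/-- The parameters `(b₁, b₂, b₃, b₄)`. -/
@[ext] structure Param where
  b1 : ℂ
  b2 : ℂ
  b3 : ℂ
  b4 : ℂ

namespace Param

def kappa0 (b : Param) : ℂ := b.b1 + b.b2

def kappa1 (b : Param) : ℂ := b.b1 - b.b2

def kappaInf (b : Param) : ℂ := b.b3 - b.b4

def theta (b : Param) : ℂ := b.b3 + b.b4 + 1

def kappa (b : Param) : ℂ :=
  (b.kappa0 + b.kappa1 + b.theta - 1) ^ 2 / 4 - b.kappaInf ^ 2 / 4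

/-- The second elementary symmetric function of `b₁, b₃, b₄`. -/
def e2three (b : Param) : ℂ := b.b1 * b.b3 + b.b1 * b.b4 + b.b3 * b.b4

/-- The second elementary symmetric function of `b₁, b₂, b₃, b₄`. -/
def e2four (b : Param) : ℂ :=
  b.b1 * b.b2 + b.b1 * b.b3 + b.b1 * b.b4 + b.b2 * b.b3 + b.b2 * b.b4 + b.b3 * b.b4

/-- The parallel shift `l₃ : (b₁, b₂, b₃, b₄) ↦ (b₁, b₂, b₃ + 1, b₄)`. -/
def l3 (b : Param) : Param := ⟨b.b1, b.b2, b.b3 + 1, b.b4⟩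

/-- The parameters of the Picard case: `(0, 0, -1/2, -1/2)`, that is
`α = β = γ = 0`, `δ = 1/2`. -/
def picard : Param := ⟨0, 0, -1 / 2, -1 / 2⟩

/-- The shifted parameters are `(0, 0, 1/2, -1/2)`. -/
theorem l3_picard : l3 picard = ⟨0, 0, 1 / 2, -1 / 2⟩ := by
  simp only [l3, picard, Param.mk.injEq, true_and, and_true]
  norm_num

end Param

/-- The Painlevé VI Hamiltonian `H(t; q, p)` with parameters `b`. -/
def hamiltonian (b : Param) (t q p : ℂ) : ℂ :=
  1 / (t * (t - 1)) *
    (q * (q - 1) * (q - t) * p ^ 2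
      - (b.kappa0 * (q - 1) * (q - t) + b.kappa1 * q * (q - t)
          + (b.theta - 1) * q * (q - 1)) * p
      + b.kappa * (q - t))

/-- The momentum `p` determined by `q` and `q' = dq/dt` through the Hamilton equation
`dq/dt = ∂H/∂p`. -/
def momentum (b : Param) (t q q' : ℂ) : ℂ :=
  (t * (t - 1) * q' + b.kappa0 * (q - 1) * (q - t) + b.kappa1 * q * (q - t)
      + (b.theta - 1) * q * (q - 1)) /
    (2 * q * (q - 1) * (q - t))

theorem hasDerivAt_hamiltonian_momentum (b : Param) (t q q' : ℂ) (ht : t ≠ 0) (ht1 : t ≠ 1)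
    (hq : q ≠ 0) (hq1 : q ≠ 1) (hqt : q ≠ t) :
    HasDerivAt (fun p => hamiltonian b t q p) q' (momentum b t q q') := by
  have h1 : t - 1 ≠ 0 := sub_ne_zero.mpr ht1
  have h2 : q - 1 ≠ 0 := sub_ne_zero.mpr hq1
  have h3 : q - t ≠ 0 := sub_ne_zero.mpr hqt
  have h := ((((hasDerivAt_id (momentum b t q q')).pow 2).const_mul
    (q * (q - 1) * (q - t))).sub ((hasDerivAt_id (momentum b t q q')).const_mul
    (b.kappa0 * (q - 1) * (q - t) + b.kappa1 * q * (q - t)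
          + (b.theta - 1) * q * (q - 1)))).add_const (b.kappa * (q - t))
  have h' := h.const_mul (1 / (t * (t - 1)))
  refine (h'.congr_deriv ?_)
  have hm : momentum b t q q' * (2 * q * (q - 1) * (q - t)) =
      t * (t - 1) * q' + b.kappa0 * (q - 1) * (q - t) + b.kappa1 * q * (q - t)
        + (b.theta - 1) * q * (q - 1) :=
    div_mul_cancel₀ _ (by simp [hq, h2, h3])
  generalize momentum b t q q' = p at hm ⊢
  simp only [id]
  field_simp
  push_cast
  linear_combination hm

/-- The auxiliary function `h = t(t-1)H + e₂(b₁,b₃,b₄) t - e₂(b₁,b₂,b₃,b₄)/2` belonging to the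
value `H` of the Hamiltonian. -/
def auxOfHam (b : Param) (t H : ℂ) : ℂ :=
  t * (t - 1) * H + b.e2three * t - b.e2four / 2

/-- The value `H` of the Hamiltonian belonging to the value `h` of the auxiliary function. -/
def hamOfAux (b : Param) (t h : ℂ) : ℂ :=
  (h - b.e2three * t + b.e2four / 2) / (t * (t - 1))

theorem auxOfHam_hamOfAux (b : Param) (t h : ℂ) (ht : t ≠ 0) (ht1 : t ≠ 1) :
    auxOfHam b t (hamOfAux b t h) = h := by
  have h1 : t - 1 ≠ 0 := sub_ne_zero.mpr ht1
  simp only [auxOfHam, hamOfAux]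
  field_simp
  ring

/-- The action of `l₃` on the auxiliary function:
`h₊ = h - q(q-1)p + (b₁+b₄)q - (b₁+b₂+b₄)/2`, which belongs to the parameters `l₃(b)`. -/
def auxShift (b : Param) (h q p : ℂ) : ℂ :=
  h - q * (q - 1) * p + (b.b1 + b.b4) * q - (b.b1 + b.b2 + b.b4) / 2

/-- The Hamiltonian belonging to the shifted auxiliary function is `H(t, q, p; l₃(b))`. -/
theorem hamOfAux_auxShift (b : Param) (t q p : ℂ) (ht : t ≠ 0) (ht1 : t ≠ 1) :
    hamOfAux b.l3 t (auxShift b (auxOfHam b t (hamiltonian b t q p)) q p) =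
      hamiltonian b.l3 t q p := by
  have h1 : t - 1 ≠ 0 := sub_ne_zero.mpr ht1
  simp only [hamOfAux, auxShift, auxOfHam, hamiltonian, Param.l3, Param.e2three, Param.e2four,
    Param.kappa, Param.kappa0, Param.kappa1, Param.kappaInf, Param.theta]
  field_simp
  ring

/-- `T` is a tau-function of `H` on `U`: it is zero-free there and `d/dt log T = H`,
i.e. `T = exp ∫ H dt`. -/
def IsTauFunction (H : ℂ → ℂ) (U : Set ℂ) (T : ℂ → ℂ) : Prop :=
  ∀ t ∈ U, T t ≠ 0 ∧ HasDerivAt T (H t * T t) t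

/-! ### The Picard solution and its shift -/

/-- The Picard solution `q₀(t) = t cn²(z,t)/dn²(z,t)`, `z = (2K(t)/π)(x + τy)`. -/
def picardQ (x y t : ℂ) : ℂ :=
  t * jacobiCn (2 * ellK t / Real.pi * (x + tauOf t * y)) t ^ 2 /
    jacobiDn (2 * ellK t / Real.pi * (x + tauOf t * y)) t ^ 2

/-- The momentum `p₀(t)` of the Picard solution. -/
def picardP (x y t : ℂ) : ℂ :=
  momentum Param.picard t (picardQ x y t) (deriv (picardQ x y) t)

/-- The Hamiltonian `H₀(t)` along the Picard solution. -/
def H0 (x y t : ℂ) : ℂ :=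
  hamiltonian Param.picard t (picardQ x y t) (picardP x y t)

/-- The auxiliary function `h₀(t)` of the Picard solution. -/
def h0 (x y t : ℂ) : ℂ := auxOfHam Param.picard t (H0 x y t)

/-- The auxiliary function `h₁(t)` obtained from the Picard solution by the shift `l₃`. -/
def h1 (x y t : ℂ) : ℂ :=
  auxShift Param.picard (h0 x y t) (picardQ x y t) (picardP x y t)

/-- The Hamiltonian `H₁(t)` obtained from the Picard solution by the shift `l₃`; its parameters
are `(0, 0, 1/2, -1/2)`. -/
def H1 (x y t : ℂ) : ℂ := hamOfAux Param.picard.l3 t (h1 x y t)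

/-- The set of `t` at which `q₀(t)` takes none of the values `1`, `t`, `0`, `∞` (these occur at
the zeros of `θ₄`, `θ₁`, `θ₂`, `θ₃` respectively), so that the canonical pair `(q₀, p₀)` is
regular. -/
def regularSet (x y : ℂ) : Set ℂ :=
  {t | t ∈ cutPlane ∧
    theta1 (x + tauOf t * y) (tauOf t) ≠ 0 ∧ theta2 (x + tauOf t * y) (tauOf t) ≠ 0 ∧
    theta3 (x + tauOf t * y) (tauOf t) ≠ 0 ∧ theta4 (x + tauOf t * y) (tauOf t) ≠ 0}

end

end PicardVI

open Filter Topology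

namespace PicardVI

noncomputable section

/-! Put z = (x+τy)/π = ξ+ητ. Let A and C be θ₃ and θ₂ at πz (`jacobiTheta₂`, `thetaC`), let c, a, a₄
be θ₂, θ₃, θ₄ at 0, and set f = C/A, L = A'/A, M = f'/f with derivatives in z. Then t = c⁴/a⁴ and q₀
= (cf/a)². Derivatives in t become τ-derivatives through t(t-1) dτ/dt = i/(πa⁴), and these become
z-derivatives through the heat equation. Second derivatives are removed by (log A)'' = κ - π²c²a²f²
and (log C)'' = κ - π²c²a²/f², where κ = θ₄''/θ₄ at 0 (`second_log_deriv`). A first integral of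
these two equations is qM² = π²a⁴(q-1)(q-t) (`wronskian_sq`).

With Y = 2η + L/(πi), the numerator of p₀ collapses to iqMY/(πa⁴) (`momentum_numerator`). For the
shifted parameters the terms linear in p disappear, so t(t-1)H₁ = -Y²/(4a⁴) - (q-t)/4
(`hamiltonian_l3_momentum`). The logarithmic derivative of the candidate, times t(t-1), is the same:
the nome power, the motion of z and the L² term complete the square -Y²/(4a⁴), the f² term gives
-q/4, and (1-t)^{1/4} gives t/4. Two tau-functions have a locally constant quotient, hence a
constant one on connected U.

The theta identities come from the product formulas relating τ to 2τ; the one transcendental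
constant is found by iterating τ ↦ 2τ towards the cusp (`logDerivQuot_eq`). The relation t = λ(τ(t))
is proved on a piece of the imaginary τ-axis by uniformising the elliptic integral with θ₂/θ₃, and
then continued over the cut plane (`modLambda_tauOf`). -/

/-! ### Derivatives of the two basic theta functions -/

/-- The second `z`-derivative of `jacobiTheta₂`, expressed through the heat equation. -/
def thetaDD (z τ : ℂ) : ℂ := 4 * Real.pi * I * jacobiTheta₂_fderiv z τ (0, 1)

theorem jacobiTheta₂_fderiv_apply (z : ℂ) {τ : ℂ} (hτ : 0 < τ.im) (b : ℂ) :
    jacobiTheta₂_fderiv z τ (b, 1) = b * jacobiTheta₂' z τ + thetaDD z τ / (4 * Real.pi * I) := by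
  have h1 : HasDerivAt (jacobiTheta₂ · τ) (jacobiTheta₂_fderiv z τ (1, 0)) z :=
    HasFDerivAt.comp_hasDerivAt_of_eq z (hasFDerivAt_jacobiTheta₂ z hτ)
      ((hasDerivAt_id z).prodMk (hasDerivAt_const z τ)) rfl
  have h2 := h1.unique (hasDerivAt_jacobiTheta₂_fst z hτ)
  have h3 : ((b, 1) : ℂ × ℂ) = b • (1, 0) + (0, 1) := by simp
  have hpi : (Real.pi : ℂ) ≠ 0 := ofReal_ne_zero.mpr Real.pi_ne_zero
  rw [h3, map_add, map_smul, h2, thetaDD, smul_eq_mul, mul_div_cancel_left₀]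
  simp [hpi]

theorem hasDerivAt_jacobiTheta₂_line (a b : ℂ) {τ : ℂ} (hτ : 0 < τ.im) :
    HasDerivAt (fun s => jacobiTheta₂ (a + b * s) s)
      (b * jacobiTheta₂' (a + b * τ) τ + thetaDD (a + b * τ) τ / (4 * Real.pi * I)) τ := by
  have h := HasFDerivAt.comp_hasDerivAt_of_eq τ (hasFDerivAt_jacobiTheta₂ (a + b * τ) hτ)
      ((((hasDerivAt_id τ).const_mul b).const_add a).prodMk (hasDerivAt_id τ)) rfl
  rw [mul_one, jacobiTheta₂_fderiv_apply _ hτ] at h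
  exact h

/-- This is the heat equation: differentiating termwise on a strip |Im u| < S gives the factor
(2πin)², which is 4πi times the factor πin² of the τ-derivative. -/
theorem hasDerivAt_jacobiTheta₂' (z : ℂ) {τ : ℂ} (hτ : 0 < τ.im) :
    HasDerivAt (jacobiTheta₂' · τ) (thetaDD z τ) z := by
  obtain ⟨S, hS⟩ := exists_gt |z.im|
  have hVo : IsOpen {u : ℂ | |u.im| < S} :=
    isOpen_lt (continuous_abs.comp continuous_im) continuous_const
  have hterm : ∀ (n : ℤ) (w : ℂ), HasDerivAt (fun w => jacobiTheta₂'_term n w τ)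
      (2 * Real.pi * I * n * (2 * Real.pi * I * n * jacobiTheta₂_term n w τ)) w := by
    intro n w
    have h := (((hasDerivAt_id w).const_mul (2 * Real.pi * I * n)).add_const
      (Real.pi * I * n ^ 2 * τ)).cexp.const_mul (2 * Real.pi * I * n)
    refine h.congr_deriv ?_
    simp only [jacobiTheta₂_term, id]
    ring
  have hsum : Summable fun n : ℤ =>
      2 * Real.pi * |(n : ℝ)| * Real.exp (-Real.pi * (τ.im * n ^ 2 - 2 * S * |(n : ℝ)|)) := by
    have := (summable_pow_mul_jacobiTheta₂_term_bound S hτ 1).mul_left (2 * Real.pi)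
    refine this.congr fun n => ?_
    push_cast
    ring
  have hbd : ∀ (n : ℤ) (w : ℂ), w ∈ {u : ℂ | |u.im| < S} → ‖jacobiTheta₂'_term n w τ‖ ≤
      2 * Real.pi * |(n : ℝ)| * Real.exp (-Real.pi * (τ.im * n ^ 2 - 2 * S * |(n : ℝ)|)) := by
    intro n w hw
    have := norm_jacobiTheta₂'_term_le hτ (le_of_lt hw) le_rfl n
    simpa using this
  have hd : ∀ n : ℤ, DifferentiableOn ℂ (fun w => jacobiTheta₂'_term n w τ) {u : ℂ | |u.im| < S} :=
    fun n w _ => (hterm n w).differentiableAt.differentiableWithinAt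
  have h1 := hasSum_deriv_of_summable_norm hsum hd hVo hbd (show z ∈ {u : ℂ | |u.im| < S} from hS)
  have h2 := differentiableOn_tsum_of_summable_norm hsum hd hVo hbd
  have h3 : DifferentiableAt ℂ (jacobiTheta₂' · τ) z := h2.differentiableAt (hVo.mem_nhds hS)
  have h4 := (hasSum_jacobiTheta₂_term_fderiv z hτ).mapL
    (ContinuousLinearMap.apply ℂ ℂ ((0, 1) : ℂ × ℂ))
  have h5 := h4.mul_left (4 * Real.pi * I)
  have h6 : deriv (jacobiTheta₂' · τ) z = thetaDD z τ := by
    refine h1.unique ?_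
    convert! h5 using 1
    funext n
    rw [(hterm n z).deriv]
    simp [jacobiTheta₂_term_fderiv, jacobiTheta₂_term]
    ring
  rw [← h6]
  exact h3.hasDerivAt

/-- `θ₂(πz|τ)`. -/
def thetaC (z τ : ℂ) : ℂ :=
  exp (I * Real.pi * τ / 4 + I * Real.pi * z) * jacobiTheta₂ (z + τ / 2) τ

/-- The first `z`-derivative of `thetaC`. -/
def thetaCD (z τ : ℂ) : ℂ :=
  exp (I * Real.pi * τ / 4 + I * Real.pi * z) *
    (I * Real.pi * jacobiTheta₂ (z + τ / 2) τ + jacobiTheta₂' (z + τ / 2) τ)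

/-- The second `z`-derivative of `thetaC`. -/
def thetaCDD (z τ : ℂ) : ℂ :=
  exp (I * Real.pi * τ / 4 + I * Real.pi * z) *
    (-Real.pi ^ 2 * jacobiTheta₂ (z + τ / 2) τ + 2 * I * Real.pi * jacobiTheta₂' (z + τ / 2) τ
      + thetaDD (z + τ / 2) τ)

theorem hasDerivAt_thetaC (z : ℂ) {τ : ℂ} (hτ : 0 < τ.im) :
    HasDerivAt (thetaC · τ) (thetaCD z τ) z := by
  have h1 := (((hasDerivAt_id z).const_mul (I * Real.pi)).const_add (I * Real.pi * τ / 4)).cexp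
  have h2 := (hasDerivAt_jacobiTheta₂_fst (z + τ / 2) hτ).comp_add_const z (τ / 2)
  refine (h1.mul h2).congr_deriv ?_
  simp only [thetaCD, id]
  ring

theorem hasDerivAt_thetaCD (z : ℂ) {τ : ℂ} (hτ : 0 < τ.im) :
    HasDerivAt (thetaCD · τ) (thetaCDD z τ) z := by
  have h1 := (((hasDerivAt_id z).const_mul (I * Real.pi)).const_add (I * Real.pi * τ / 4)).cexp
  have h2 := (hasDerivAt_jacobiTheta₂_fst (z + τ / 2) hτ).comp_add_const z (τ / 2)
  have h3 := (hasDerivAt_jacobiTheta₂' (z + τ / 2) hτ).comp_add_const z (τ / 2)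
  refine (h1.mul ((h2.const_mul (I * Real.pi)).add h3)).congr_deriv ?_
  simp only [thetaCDD, id, Pi.add_apply]
  linear_combination (Real.pi ^ 2 * jacobiTheta₂ (z + τ / 2) τ *
    exp (I * Real.pi * τ / 4 + I * Real.pi * z)) * I_sq

theorem hasDerivAt_thetaC_line (a b : ℂ) {τ : ℂ} (hτ : 0 < τ.im) :
    HasDerivAt (fun s => thetaC (a + b * s) s)
      (b * thetaCD (a + b * τ) τ + thetaCDD (a + b * τ) τ / (4 * Real.pi * I)) τ := by
  have h1 := ((((hasDerivAt_id τ).const_mul (I * Real.pi)).div_const 4).add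
    ((((hasDerivAt_id τ).const_mul b).const_add a).const_mul (I * Real.pi))).cexp
  have h2 := hasDerivAt_jacobiTheta₂_line a (b + 1 / 2) hτ
  have e : ∀ s : ℂ, a + (b + 1 / 2) * s = a + b * s + s / 2 := fun s => by ring
  simp only [e] at h2
  refine (h1.mul h2).congr_deriv ?_
  have hpi : (Real.pi : ℂ) ≠ 0 := ofReal_ne_zero.mpr Real.pi_ne_zero
  simp only [thetaCD, thetaCDD, id, Pi.add_apply]
  field_simp
  ring_nf
  simp only [I_sq]
  ring

theorem hasDerivAt_thetaC_snd {τ : ℂ} (hτ : 0 < τ.im) :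
    HasDerivAt (fun s => thetaC 0 s) (thetaCDD 0 τ / (4 * Real.pi * I)) τ := by
  simpa using hasDerivAt_thetaC_line 0 0 hτ

theorem hasDerivAt_jacobiTheta₂_snd (a : ℂ) {τ : ℂ} (hτ : 0 < τ.im) :
    HasDerivAt (fun s => jacobiTheta₂ a s) (thetaDD a τ / (4 * Real.pi * I)) τ := by
  simpa using hasDerivAt_jacobiTheta₂_line a 0 hτ

/-! ### Symmetries -/

theorem thetaC_eq_add_half (z τ : ℂ) :
    jacobiTheta₂ (z + τ / 2) τ = exp (-(I * Real.pi * τ / 4 + I * Real.pi * z)) * thetaC z τ := by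
  rw [thetaC, ← mul_assoc, ← exp_add, neg_add_cancel, exp_zero, one_mul]

theorem thetaC_neg (z τ : ℂ) : thetaC (-z) τ = thetaC z τ := by
  have h := jacobiTheta₂_add_left' (z - τ / 2) τ
  rw [show z - τ / 2 + τ = z + τ / 2 by ring] at h
  rw [thetaC, thetaC, ← jacobiTheta₂_neg_left, show -(-z + τ / 2) = z - τ / 2 by ring, h,
    ← mul_assoc, ← exp_add]
  congr 2
  ring

theorem thetaC_add_one (z τ : ℂ) : thetaC (z + 1) τ = -thetaC z τ := by
  rw [thetaC, thetaC, show z + 1 + τ / 2 = z + τ / 2 + 1 by ring, jacobiTheta₂_add_left,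
    show I * Real.pi * τ / 4 + I * Real.pi * (z + 1) =
      (I * Real.pi * τ / 4 + I * Real.pi * z) + Real.pi * I by ring, exp_add, exp_pi_mul_I]
  ring

theorem thetaC_add_half (z τ : ℂ) : thetaC (z + τ / 2) τ =
    exp (-(I * Real.pi * τ / 4 + I * Real.pi * z)) * jacobiTheta₂ z τ := by
  rw [thetaC, show z + τ / 2 + τ / 2 = z + τ by ring, jacobiTheta₂_add_left', ← mul_assoc,
    ← exp_add]
  congr 2
  ring

theorem thetaC_half (τ : ℂ) : thetaC (1 / 2) τ = 0 := by
  have h1 := thetaC_add_one (-(1 / 2)) τ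
  rw [thetaC_neg, show (-(1 / 2) + 1 : ℂ) = 1 / 2 by norm_num] at h1
  have : (2 : ℂ) * thetaC (1 / 2) τ = 0 := by linear_combination h1
  simpa using this

theorem jacobiTheta₂'_zero (τ : ℂ) : jacobiTheta₂' 0 τ = 0 := by
  have h := jacobiTheta₂'_neg_left 0 τ
  rw [neg_zero] at h
  have : (2 : ℂ) * jacobiTheta₂' 0 τ = 0 := by linear_combination h
  simpa using this

theorem jacobiTheta₂'_half (τ : ℂ) : jacobiTheta₂' (1 / 2) τ = 0 := by
  have h := jacobiTheta₂'_neg_left (1 / 2) τ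
  have h1 := jacobiTheta₂'_add_left (-(1 / 2)) τ
  rw [show (-(1 / 2) + 1 : ℂ) = 1 / 2 by norm_num] at h1
  have : (2 : ℂ) * jacobiTheta₂' (1 / 2) τ = 0 := by linear_combination h + h1
  simpa using this

theorem thetaCD_zero {τ : ℂ} (hτ : 0 < τ.im) : thetaCD 0 τ = 0 := by
  have h := hasDerivAt_thetaC 0 hτ
  have h2 : HasDerivAt (fun z => thetaC (-z) τ) (-thetaCD 0 τ) 0 := by
    have := (hasDerivAt_thetaC (0 - 0) hτ).comp_const_sub 0 0
    simpa using this
  simp only [thetaC_neg] at h2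
  have h3 := h.unique h2
  have : (2 : ℂ) * thetaCD 0 τ = 0 := by linear_combination h3
  simpa using this

/-! ### Addition formulas -/

/-- The even and odd sublattices of `ℤ × ℤ`, parametrised by `(k, l) ↦ (k + l, k - l)` and
`(k, l) ↦ (k + l + 1, k - l)`. -/
def parityEquiv : (ℤ × ℤ) ⊕ (ℤ × ℤ) ≃ ℤ × ℤ where
  toFun := Sum.elim (fun p => (p.1 + p.2, p.1 - p.2)) (fun p => (p.1 + p.2 + 1, p.1 - p.2))
  invFun p := if (p.1 + p.2) % 2 = 0 then Sum.inl ((p.1 + p.2) / 2, (p.1 - p.2) / 2)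
    else Sum.inr ((p.1 + p.2 - 1) / 2, (p.1 - p.2 - 1) / 2)
  left_inv := by
    rintro (⟨k, l⟩ | ⟨k, l⟩)
    · have h : (k + l + (k - l)) % 2 = 0 := by omega
      simp only [Sum.elim_inl, h, if_true, Sum.inl.injEq, Prod.mk.injEq]
      omega
    · have h : ¬(k + l + 1 + (k - l)) % 2 = 0 := by omega
      simp only [Sum.elim_inr, h, if_false, Sum.inr.injEq, Prod.mk.injEq]
      omega
  right_inv := by
    rintro ⟨m, n⟩
    dsimp only
    split_ifs with h
    · simp only [Sum.elim_inl, Prod.mk.injEq]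
      omega
    · simp only [Sum.elim_inr, Prod.mk.injEq]
      omega

theorem hasSum_thetaC (z : ℂ) {τ : ℂ} (hτ : 0 < τ.im) :
    HasSum (fun n : ℤ => exp (I * Real.pi * τ / 4 + I * Real.pi * z) *
      jacobiTheta₂_term n (z + τ / 2) τ) (thetaC z τ) :=
  (hasSum_jacobiTheta₂_term _ hτ).mul_left _

theorem hasSum_mul_prod {f g : ℤ → ℂ} {a b : ℂ} (hf : HasSum f a) (hg : HasSum g b) :
    HasSum (fun p : ℤ × ℤ => f p.1 * g p.2) (a * b) :=
  hf.mul hg (summable_mul_of_summable_norm hf.summable.norm hg.summable.norm)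

theorem hasSum_sumType {α β : Type*} {f : α ⊕ β → ℂ} {a b : ℂ}
    (ha : HasSum (f ∘ Sum.inl) a) (hb : HasSum (f ∘ Sum.inr) b) : HasSum f (a + b) :=
  (Sum.inl_injective.hasSum_range_iff.mpr ha).add_isCompl Set.isCompl_range_inl_range_inr
    (Sum.inr_injective.hasSum_range_iff.mpr hb)

/-- Since (k+l)² + (k-l)² = 2(k²+l²), index pairs of equal parity give a product of two θ₃ series at
2τ. Pairs of opposite parity give the half-integer indices of θ₂. -/
theorem jacobiTheta₂_mul (z w : ℂ) {τ : ℂ} (hτ : 0 < τ.im) :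
    jacobiTheta₂ (z + w) τ * jacobiTheta₂ (z - w) τ =
      jacobiTheta₂ (2 * z) (2 * τ) * jacobiTheta₂ (2 * w) (2 * τ) +
        thetaC (2 * z) (2 * τ) * thetaC (2 * w) (2 * τ) := by
  have h2 : 0 < (2 * τ).im := by simpa using hτ
  have hL := hasSum_mul_prod (hasSum_jacobiTheta₂_term (z + w) hτ)
    (hasSum_jacobiTheta₂_term (z - w) hτ)
  have hA := hasSum_mul_prod (hasSum_jacobiTheta₂_term (2 * z) h2)
    (hasSum_jacobiTheta₂_term (2 * w) h2)
  have hB := hasSum_mul_prod (hasSum_thetaC (2 * z) h2) (hasSum_thetaC (2 * w) h2)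
  rw [← parityEquiv.hasSum_iff] at hL
  refine hL.unique (hasSum_sumType ?_ ?_)
  · convert! hA using 1
    funext ⟨k, l⟩
    simp only [parityEquiv, Function.comp_apply, Equiv.coe_fn_mk, Sum.elim_inl, jacobiTheta₂_term,
      ← exp_add]
    congr 1
    push_cast
    ring
  · convert! hB using 1
    funext ⟨k, l⟩
    simp only [parityEquiv, Function.comp_apply, Equiv.coe_fn_mk, Sum.elim_inr, jacobiTheta₂_term,
      ← exp_add]
    congr 1
    push_cast
    ring

theorem thetaC_mul (z w : ℂ) {τ : ℂ} (hτ : 0 < τ.im) :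
    thetaC (z + w) τ * thetaC (z - w) τ =
      jacobiTheta₂ (2 * z) (2 * τ) * thetaC (2 * w) (2 * τ) +
        thetaC (2 * z) (2 * τ) * jacobiTheta₂ (2 * w) (2 * τ) := by
  have h := jacobiTheta₂_mul (z + τ / 2) w hτ
  have e1 : 2 * (z + τ / 2) = 2 * z + (2 * τ) / 2 := by ring
  rw [e1, thetaC_add_half, thetaC_eq_add_half, show z + τ / 2 + w = (z + w) + τ / 2 by ring,
    show z + τ / 2 - w = (z - w) + τ / 2 by ring, thetaC_eq_add_half, thetaC_eq_add_half] at h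
  have e2 : exp (-(I * Real.pi * τ / 4 + I * Real.pi * (z + w))) *
      exp (-(I * Real.pi * τ / 4 + I * Real.pi * (z - w))) =
      exp (-(I * Real.pi * (2 * τ) / 4 + I * Real.pi * (2 * z))) := by
    rw [← exp_add]
    congr 1
    ring
  refine mul_left_cancel₀ (exp_ne_zero (-(I * Real.pi * (2 * τ) / 4 + I * Real.pi * (2 * z)))) ?_
  linear_combination h - (thetaC (z + w) τ * thetaC (z - w) τ) * e2

/-! ### Squares of theta functions and doubling of the period -/

theorem jacobiTheta₂_sq (z : ℂ) {τ : ℂ} (hτ : 0 < τ.im) :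
    jacobiTheta₂ z τ ^ 2 = jacobiTheta₂ (2 * z) (2 * τ) * jacobiTheta₂ 0 (2 * τ) +
        thetaC (2 * z) (2 * τ) * thetaC 0 (2 * τ) := by
  simpa [sq] using jacobiTheta₂_mul z 0 hτ

theorem thetaC_sq (z : ℂ) {τ : ℂ} (hτ : 0 < τ.im) :
    thetaC z τ ^ 2 = jacobiTheta₂ (2 * z) (2 * τ) * thetaC 0 (2 * τ) +
        thetaC (2 * z) (2 * τ) * jacobiTheta₂ 0 (2 * τ) := by
  simpa [sq] using thetaC_mul z 0 hτ

theorem jacobiTheta₂_add_half_sq (z : ℂ) {τ : ℂ} (hτ : 0 < τ.im) :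
    jacobiTheta₂ (z + 1 / 2) τ ^ 2 = jacobiTheta₂ (2 * z) (2 * τ) * jacobiTheta₂ 0 (2 * τ) -
        thetaC (2 * z) (2 * τ) * thetaC 0 (2 * τ) := by
  rw [jacobiTheta₂_sq _ hτ, show 2 * (z + 1 / 2) = 2 * z + 1 by ring, jacobiTheta₂_add_left,
    thetaC_add_one]
  ring

theorem thetaC_add_half_sq (z : ℂ) {τ : ℂ} (hτ : 0 < τ.im) :
    thetaC (z + 1 / 2) τ ^ 2 = jacobiTheta₂ (2 * z) (2 * τ) * thetaC 0 (2 * τ) -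
        thetaC (2 * z) (2 * τ) * jacobiTheta₂ 0 (2 * τ) := by
  rw [thetaC_sq _ hτ, show 2 * (z + 1 / 2) = 2 * z + 1 by ring, jacobiTheta₂_add_left,
    thetaC_add_one]
  ring

theorem jacobiTheta₂_zero_sq {τ : ℂ} (hτ : 0 < τ.im) :
    jacobiTheta₂ 0 τ ^ 2 = jacobiTheta₂ 0 (2 * τ) ^ 2 + thetaC 0 (2 * τ) ^ 2 := by
  simpa [sq] using jacobiTheta₂_sq 0 hτ

theorem thetaC_zero_sq {τ : ℂ} (hτ : 0 < τ.im) :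
    thetaC 0 τ ^ 2 = 2 * jacobiTheta₂ 0 (2 * τ) * thetaC 0 (2 * τ) := by
  have := thetaC_sq 0 hτ
  rw [mul_zero] at this
  linear_combination this

theorem jacobiTheta₂_half_sq {τ : ℂ} (hτ : 0 < τ.im) :
    jacobiTheta₂ (1 / 2) τ ^ 2 = jacobiTheta₂ 0 (2 * τ) ^ 2 - thetaC 0 (2 * τ) ^ 2 := by
  have := jacobiTheta₂_add_half_sq 0 hτ
  rw [mul_zero, zero_add] at this
  linear_combination this

/-- The choice z = w = 1/4 in the product formula kills the second term, because θ₂ vanishes at the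
half period. -/
theorem jacobiTheta₂_half_two_mul_sq {τ : ℂ} (hτ : 0 < τ.im) :
    jacobiTheta₂ (1 / 2) (2 * τ) ^ 2 = jacobiTheta₂ 0 τ * jacobiTheta₂ (1 / 2) τ := by
  have h := jacobiTheta₂_mul (1 / 4) (1 / 4) hτ
  rw [show (1 / 4 + 1 / 4 : ℂ) = 1 / 2 by norm_num, sub_self,
    show (2 * (1 / 4) : ℂ) = 1 / 2 by norm_num, thetaC_half] at h
  linear_combination -h

/-- Jacobi's quartic identity. -/
theorem theta_quartic {τ : ℂ} (hτ : 0 < τ.im) :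
    jacobiTheta₂ 0 τ ^ 4 = thetaC 0 τ ^ 4 + jacobiTheta₂ (1 / 2) τ ^ 4 := by
  have e : ∀ w : ℂ, w ^ 4 = (w ^ 2) ^ 2 := fun w => by ring
  rw [e, e (thetaC 0 τ), e (jacobiTheta₂ (1 / 2) τ), jacobiTheta₂_zero_sq hτ, thetaC_zero_sq hτ,
    jacobiTheta₂_half_sq hτ]
  ring

theorem jacobiTheta₂_add_half_sq_eq (z : ℂ) {τ : ℂ} (hτ : 0 < τ.im) :
    jacobiTheta₂ (1 / 2) τ ^ 2 * jacobiTheta₂ (z + 1 / 2) τ ^ 2 =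
      jacobiTheta₂ 0 τ ^ 2 * jacobiTheta₂ z τ ^ 2 - thetaC 0 τ ^ 2 * thetaC z τ ^ 2 := by
  rw [jacobiTheta₂_half_sq hτ, jacobiTheta₂_add_half_sq z hτ, jacobiTheta₂_zero_sq hτ,
    jacobiTheta₂_sq z hτ, thetaC_zero_sq hτ, thetaC_sq z hτ]
  ring

theorem thetaC_add_half_sq_eq (z : ℂ) {τ : ℂ} (hτ : 0 < τ.im) :
    jacobiTheta₂ (1 / 2) τ ^ 2 * thetaC (z + 1 / 2) τ ^ 2 =
      thetaC 0 τ ^ 2 * jacobiTheta₂ z τ ^ 2 - jacobiTheta₂ 0 τ ^ 2 * thetaC z τ ^ 2 := by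
  rw [jacobiTheta₂_half_sq hτ, thetaC_add_half_sq z hτ, jacobiTheta₂_zero_sq hτ,
    jacobiTheta₂_sq z hτ, thetaC_zero_sq hτ, thetaC_sq z hτ]
  ring

/-! ### Second logarithmic derivatives -/

/-- Two w-derivatives at w = 0 turn f(z+w)f(z-w) into 2(ff'' - f'²); on the right the inner factor 2
contributes 4. -/
theorem second_deriv_of_mul_eq {f f' f'' g g' g'' h h' h'' : ℂ → ℂ} {X Y : ℂ} (z : ℂ)
    (hf : ∀ w, HasDerivAt f (f' w) w) (hf' : ∀ w, HasDerivAt f' (f'' w) w)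
    (hg : ∀ w, HasDerivAt g (g' w) w) (hg' : ∀ w, HasDerivAt g' (g'' w) w)
    (hh : ∀ w, HasDerivAt h (h' w) w) (hh' : ∀ w, HasDerivAt h' (h'' w) w)
    (H : ∀ w, f (z + w) * f (z - w) = X * g (2 * w) + Y * h (2 * w)) :
    f z * f'' z - f' z ^ 2 = 2 * (X * g'' 0 + Y * h'' 0) := by
  have dbl : ∀ {k k' : ℂ → ℂ}, (∀ w, HasDerivAt k (k' w) w) → ∀ w,
      HasDerivAt (fun w => k (2 * w)) (k' (2 * w) * 2) w := fun {k k'} hk w =>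
    HasDerivAt.comp w (hk (2 * w)) (by simpa using (hasDerivAt_id w).const_mul 2)
  have H1 : ∀ w, f' (z + w) * f (z - w) - f (z + w) * f' (z - w) =
      X * (g' (2 * w) * 2) + Y * (h' (2 * w) * 2) := by
    intro w
    have e1 := ((hf (z + w)).comp_const_add z w).mul ((hf (z - w)).comp_const_sub z w)
    have e2 := ((dbl hg w).const_mul X).add ((dbl hh w).const_mul Y)
    have e3 : (fun w => f (z + w)) * (fun w => f (z - w)) =
      (fun w => X * g (2 * w)) + (fun w => Y * h (2 * w)) := funext H
    rw [e3] at e1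
    linear_combination e1.unique e2
  have e1 := (((hf' (z + 0)).comp_const_add z 0).mul ((hf (z - 0)).comp_const_sub z 0)).sub
    (((hf (z + 0)).comp_const_add z 0).mul ((hf' (z - 0)).comp_const_sub z 0))
  have e2 := (((dbl hg' 0).mul_const 2).const_mul X).add (((dbl hh' 0).mul_const 2).const_mul Y)
  have e3 : (fun w => f' (z + w)) * (fun w => f (z - w)) -
      (fun w => f (z + w)) * (fun w => f' (z - w)) =
      (fun w => X * (g' (2 * w) * 2)) + (fun w => Y * (h' (2 * w) * 2)) := funext H1
  rw [e3] at e1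
  have e4 := e1.unique e2
  simp only [add_zero, sub_zero, mul_zero] at e4
  linear_combination e4 / 2

/-- The second logarithmic derivatives of `jacobiTheta₂` and `thetaC` are linear in the squares
of their quotients, with the same coefficients. -/
theorem exists_second_log_deriv {τ : ℂ} (hτ : 0 < τ.im) (h4 : jacobiTheta₂ (1 / 2) τ ≠ 0) :
    ∃ a b : ℂ, ∀ z,
      jacobiTheta₂ z τ * thetaDD z τ - jacobiTheta₂' z τ ^ 2 =
        a * jacobiTheta₂ z τ ^ 2 + b * thetaC z τ ^ 2 ∧
      thetaC z τ * thetaCDD z τ - thetaCD z τ ^ 2 =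
        a * thetaC z τ ^ 2 + b * jacobiTheta₂ z τ ^ 2 := by
  have h2 : 0 < (2 * τ).im := by simpa using hτ
  have h4' := pow_ne_zero 2 h4
  rw [jacobiTheta₂_half_sq hτ] at h4'
  set A := jacobiTheta₂ 0 (2 * τ) with hA
  set B := thetaC 0 (2 * τ) with hB
  set α := 2 * thetaDD 0 (2 * τ) with hα
  set β := 2 * thetaCDD 0 (2 * τ) with hβ
  -- With X, Y the values of θ₃, θ₂ at (2z|2τ), the squares are θ₃² = AX + BY and θ₂² = BX + AY, and
  -- the left sides are αX + βY and βX + αY. So a, b solve aA + bB = α, aB + bA = β, with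
  -- determinant A² - B² = θ₄(0|τ)².
  refine ⟨(α * A - β * B) / (A ^ 2 - B ^ 2), (β * A - α * B) / (A ^ 2 - B ^ 2), fun z => ?_⟩
  have e3 := second_deriv_of_mul_eq z (fun w => hasDerivAt_jacobiTheta₂_fst w hτ)
    (fun w => hasDerivAt_jacobiTheta₂' w hτ) (fun w => hasDerivAt_jacobiTheta₂_fst w h2)
    (fun w => hasDerivAt_jacobiTheta₂' w h2) (fun w => hasDerivAt_thetaC w h2)
    (fun w => hasDerivAt_thetaCD w h2) (fun w => jacobiTheta₂_mul z w hτ)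
  have e2 := second_deriv_of_mul_eq z (fun w => hasDerivAt_thetaC w hτ)
    (fun w => hasDerivAt_thetaCD w hτ) (fun w => hasDerivAt_thetaC w h2)
    (fun w => hasDerivAt_thetaCD w h2) (fun w => hasDerivAt_jacobiTheta₂_fst w h2)
    (fun w => hasDerivAt_jacobiTheta₂' w h2) (fun w => thetaC_mul z w hτ)
  rw [e3, e2, jacobiTheta₂_sq z hτ, thetaC_sq z hτ, ← hA, ← hB]
  constructor
  · field_simp
    rw [hα, hβ]
    ring
  · field_simp
    rw [hα, hβ]
    ring

/-! ### The expansion at the cusp -/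

/-- `∑_{n ≥ 0} q^{n² + 2n}`, so that `θ₃ = 1 + 2 q · nomeTail q`. -/
def nomeTail (q : ℂ) : ℂ := ∑' n : ℕ, q ^ (n ^ 2 + 2 * n)

theorem differentiableAt_nomeTail {q : ℂ} (hq : ‖q‖ < 1) : DifferentiableAt ℂ nomeTail q := by
  obtain ⟨r, hr, hr1⟩ := exists_between hq
  have hr0 : 0 ≤ r := (norm_nonneg q).trans hr.le
  have hU : IsOpen (Metric.ball (0 : ℂ) r) := Metric.isOpen_ball
  refine DifferentiableOn.differentiableAt (s := Metric.ball (0 : ℂ) r) ?_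
    (hU.mem_nhds (by simpa using hr))
  refine differentiableOn_tsum_of_summable_norm (summable_geometric_of_lt_one hr0 hr1)
    (fun n => (differentiable_id.pow _).differentiableOn) hU fun n w hw => ?_
  have hw' : ‖w‖ ≤ r := by simpa using (mem_ball_zero_iff.mp hw).le
  rw [norm_pow]
  calc ‖w‖ ^ (n ^ 2 + 2 * n) ≤ r ^ (n ^ 2 + 2 * n) := pow_le_pow_left₀ (norm_nonneg _) hw' _
    _ ≤ r ^ n := pow_le_pow_of_le_one hr0 hr1.le (by nlinarith [Nat.zero_le n])

theorem nomeTail_zero : nomeTail 0 = 1 := by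
  rw [nomeTail, tsum_eq_single 0]
  · simp
  · intro n hn
    exact zero_pow (by positivity)

/-- `θ₃` as a function of the nome. -/
def nomeTheta (q : ℂ) : ℂ := 1 + 2 * (q * nomeTail q)

theorem nomeTheta_zero : nomeTheta 0 = 1 := by simp [nomeTheta]

theorem differentiableAt_nomeTheta {q : ℂ} (hq : ‖q‖ < 1) : DifferentiableAt ℂ nomeTheta q :=
  ((differentiableAt_id.mul (differentiableAt_nomeTail hq)).const_mul 2).const_add 1

theorem hasDerivAt_nomeTheta_zero : HasDerivAt nomeTheta 2 0 := by
  have h := (((hasDerivAt_id (0 : ℂ)).mul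
    (differentiableAt_nomeTail (q := 0) (by simp)).hasDerivAt).const_mul 2).const_add 1
  refine h.congr_deriv ?_
  simp [nomeTail_zero]

theorem norm_nome_lt_one {τ : ℂ} (hτ : 0 < τ.im) : ‖exp (I * Real.pi * τ)‖ < 1 := by
  rw [norm_exp, Real.exp_lt_one_iff]
  simp
  positivity

theorem jacobiTheta₂_zero_eq_nomeTheta {τ : ℂ} (hτ : 0 < τ.im) :
    jacobiTheta₂ 0 τ = nomeTheta (exp (I * Real.pi * τ)) := by
  rw [← jacobiTheta_eq_jacobiTheta₂, jacobiTheta_eq_tsum_nat hτ, nomeTheta, nomeTail]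
  have h : ∀ n : ℕ, exp (Real.pi * I * ((n : ℂ) + 1) ^ 2 * τ) =
      exp (I * Real.pi * τ) * exp (I * Real.pi * τ) ^ (n ^ 2 + 2 * n) := by
    intro n
    rw [← pow_succ', ← exp_nat_mul]
    congr 1
    push_cast
    ring
  rw [tsum_congr h, tsum_mul_left]

/-- As n² ≡ n mod 2, the sign (-1)ⁿ of the half-period shift is the one produced by τ ↦ τ+1. In the
nome this is q ↦ -q. -/
theorem jacobiTheta₂_half_eq (τ : ℂ) : jacobiTheta₂ (1 / 2) τ = jacobiTheta₂ 0 (τ + 1) := by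
  rw [jacobiTheta₂, jacobiTheta₂]
  refine tsum_congr fun n => ?_
  have h : (n ^ 2 : ℤ) = n + 2 * (n * (n - 1) / 2) := by
    have := Int.mul_ediv_cancel' (even_iff_two_dvd.mp (Int.even_mul_pred_self n))
    linear_combination -this
  have h' : (n : ℂ) ^ 2 = n + 2 * ((n * (n - 1) / 2 : ℤ) : ℂ) := by exact_mod_cast h
  rw [jacobiTheta₂_term, jacobiTheta₂_term, exp_eq_exp_iff_exists_int]
  refine ⟨-(n * (n - 1) / 2), ?_⟩
  rw [Int.cast_neg]
  linear_combination (-Real.pi * I) * h'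

theorem jacobiTheta₂_half_eq_nomeTheta {τ : ℂ} (hτ : 0 < τ.im) :
    jacobiTheta₂ (1 / 2) τ = nomeTheta (-exp (I * Real.pi * τ)) := by
  rw [jacobiTheta₂_half_eq, jacobiTheta₂_zero_eq_nomeTheta (by simpa using hτ), mul_add, exp_add,
    mul_one, mul_comm I (Real.pi : ℂ), exp_pi_mul_I, mul_neg_one]

/-! ### Non-vanishing of the theta constants -/

theorem im_two_pow_mul_pos {τ : ℂ} (hτ : 0 < τ.im) (n : ℕ) : 0 < (2 ^ n * τ).im := by
  have : (2 ^ n * τ : ℂ) = ((2 ^ n : ℝ) : ℂ) * τ := by push_cast; rfl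
  rw [this, im_ofReal_mul]
  positivity

theorem tendsto_nome_two_pow {τ : ℂ} (hτ : 0 < τ.im) :
    Tendsto (fun n : ℕ => exp (I * Real.pi * (2 ^ n * τ))) atTop (𝓝[≠] 0) := by
  rw [tendsto_nhdsWithin_iff]
  refine ⟨?_, Eventually.of_forall fun n => exp_ne_zero _⟩
  have h := (tendsto_pow_atTop_nhds_zero_of_norm_lt_one (norm_nome_lt_one hτ)).comp
    (tendsto_pow_atTop_atTop_of_one_lt (one_lt_two : (1 : ℕ) < 2))
  refine h.congr fun n => ?_
  rw [Function.comp_apply, ← exp_nat_mul]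
  congr 1
  push_cast
  ring

theorem hasDerivAt_nomeTheta_neg_zero : HasDerivAt (fun q => nomeTheta (-q)) (-2) 0 := by
  have h := (show HasDerivAt nomeTheta 2 (0 - 0) by
    simpa using hasDerivAt_nomeTheta_zero).comp_const_sub 0 0
  simpa using h

theorem hasDerivAt_nomeTheta_quartic :
    HasDerivAt (fun q => nomeTheta q ^ 4 - nomeTheta (-q) ^ 4) 16 0 := by
  refine ((hasDerivAt_nomeTheta_zero.pow 4).sub
    (hasDerivAt_nomeTheta_neg_zero.pow 4)).congr_deriv ?_
  simp only [neg_zero, nomeTheta_zero]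
  norm_num

theorem thetaC_zero_pow_four {τ : ℂ} (hτ : 0 < τ.im) :
    thetaC 0 τ ^ 4 = nomeTheta (exp (I * Real.pi * τ)) ^ 4 -
      nomeTheta (-exp (I * Real.pi * τ)) ^ 4 := by
  rw [← jacobiTheta₂_zero_eq_nomeTheta hτ, ← jacobiTheta₂_half_eq_nomeTheta hτ, theta_quartic hτ]
  ring

/-- By the doubling formulas a zero of θ₂θ₃θ₄ at τ propagates to 2τ, hence to all 2ⁿτ. There the
nome tends to 0, where θ₃, θ₄ → 1 and θ₂⁴ = 16q + o(q) is non-zero for small q ≠ 0. -/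
theorem theta_constants_ne_zero {τ : ℂ} (hτ : 0 < τ.im) :
    thetaC 0 τ ≠ 0 ∧ jacobiTheta₂ 0 τ ≠ 0 ∧ jacobiTheta₂ (1 / 2) τ ≠ 0 := by
  by_contra hcon
  have hz : thetaC 0 τ * (jacobiTheta₂ 0 τ * jacobiTheta₂ (1 / 2) τ) = 0 := by
    by_contra h
    exact hcon ⟨left_ne_zero_of_mul h, left_ne_zero_of_mul (right_ne_zero_of_mul h),
      right_ne_zero_of_mul (right_ne_zero_of_mul h)⟩
  have hall : ∀ n : ℕ, thetaC 0 (2 ^ n * τ) *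
      (jacobiTheta₂ 0 (2 ^ n * τ) * jacobiTheta₂ (1 / 2) (2 ^ n * τ)) = 0 := by
    intro n
    induction n with
    | zero => simpa using hz
    | succ n ih =>
      have hn := im_two_pow_mul_pos hτ n
      have e : (2 ^ (n + 1) * τ : ℂ) = 2 * (2 ^ n * τ) := by ring
      have h1 := congrArg (· ^ 2) ih
      simp only [mul_pow] at h1
      rw [← mul_pow, ← mul_pow, ← jacobiTheta₂_half_two_mul_sq hn, mul_pow, thetaC_zero_sq hn] at h1
      rw [e]
      simp only [ne_eq, OfNat.ofNat_ne_zero, not_false_eq_true, zero_pow, mul_eq_zero,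
        pow_eq_zero_iff, false_or] at h1 ⊢
      tauto
  have hφ : ContinuousAt nomeTheta 0 := hasDerivAt_nomeTheta_zero.continuousAt
  have hφ' : ContinuousAt (fun q => nomeTheta (-q)) 0 := hasDerivAt_nomeTheta_neg_zero.continuousAt
  have e1 : ∀ᶠ q in 𝓝[≠] (0 : ℂ), nomeTheta q ≠ 0 :=
    (hφ.eventually_ne (by simp [nomeTheta_zero])).filter_mono nhdsWithin_le_nhds
  have e2 : ∀ᶠ q in 𝓝[≠] (0 : ℂ), nomeTheta (-q) ≠ 0 :=
    (hφ'.eventually_ne (by simp [nomeTheta_zero])).filter_mono nhdsWithin_le_nhds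
  have e3 : ∀ᶠ q in 𝓝[≠] (0 : ℂ), nomeTheta q ^ 4 - nomeTheta (-q) ^ 4 ≠ 0 :=
    hasDerivAt_nomeTheta_quartic.eventually_ne (by norm_num)
  obtain ⟨n, h1, h2, h3⟩ := ((tendsto_nome_two_pow hτ).eventually (e1.and (e2.and e3))).exists
  have hn := im_two_pow_mul_pos hτ n
  rw [← thetaC_zero_pow_four hn] at h3
  rw [← jacobiTheta₂_zero_eq_nomeTheta hn] at h1
  rw [← jacobiTheta₂_half_eq_nomeTheta hn] at h2
  exact mul_ne_zero (fun h => h3 (by simp [h])) (mul_ne_zero h1 h2) (hall n)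

/-! ### The logarithmic derivative of `θ₄ / θ₃` -/

theorem eventually_im_pos {τ : ℂ} (hτ : 0 < τ.im) : ∀ᶠ s : ℂ in 𝓝 τ, 0 < s.im :=
  (isOpen_lt continuous_const continuous_im).mem_nhds hτ

/-- The quotient of the logarithmic derivative of `θ₄ / θ₃` by `θ₂⁴`. -/
def logDerivQuot (τ : ℂ) : ℂ :=
  (thetaDD (1 / 2) τ / (4 * Real.pi * I) / jacobiTheta₂ (1 / 2) τ -
    thetaDD 0 τ / (4 * Real.pi * I) / jacobiTheta₂ 0 τ) / thetaC 0 τ ^ 4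

/-- Differentiating θ₄(2τ)² = θ₃θ₄ and 2θ₃(2τ)² = θ₃² + θ₄² gives the logarithmic derivatives at 2τ.
With A, B = θ₃, θ₂ at 2τ, passing to 2τ multiplies both the difference of logarithmic derivatives
and θ₂⁴ by B²/(4A²). -/
theorem logDerivQuot_two_mul {τ : ℂ} (hτ : 0 < τ.im) :
    logDerivQuot (2 * τ) = logDerivQuot τ := by
  have h2 : 0 < (2 * τ).im := by simpa using hτ
  obtain ⟨n2, n3, n4⟩ := theta_constants_ne_zero hτ
  obtain ⟨m2, m3, m4⟩ := theta_constants_ne_zero h2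
  have dbl : ∀ a : ℂ, HasDerivAt (fun s => jacobiTheta₂ a (2 * s))
      (thetaDD a (2 * τ) / (4 * Real.pi * I) * 2) τ := fun a =>
    HasDerivAt.comp τ (hasDerivAt_jacobiTheta₂_snd a h2)
      (by simpa using (hasDerivAt_id τ).const_mul 2)
  have sgl := fun a : ℂ => hasDerivAt_jacobiTheta₂_snd a hτ
  have E4 := ((dbl (1 / 2)).pow 2).unique (((sgl 0).mul (sgl (1 / 2))).congr_of_eventuallyEq
    ((eventually_im_pos hτ).mono fun s hs => jacobiTheta₂_half_two_mul_sq hs))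
  have E3 := (((dbl 0).pow 2).const_mul 2).unique
    ((((sgl 0).pow 2).add ((sgl (1 / 2)).pow 2)).congr_of_eventuallyEq
    ((eventually_im_pos hτ).mono fun s hs => by
      simp only [Pi.add_apply, Pi.pow_apply]
      rw [jacobiTheta₂_zero_sq hs, jacobiTheta₂_half_sq hs]
      ring))
  have q4 := jacobiTheta₂_half_two_mul_sq hτ
  have q3 := jacobiTheta₂_zero_sq hτ
  have q4' := jacobiTheta₂_half_sq hτ
  have q2 := thetaC_zero_sq hτ
  unfold logDerivQuot
  generalize thetaDD 0 τ / (4 * Real.pi * I) = D3 at *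
  generalize thetaDD (1 / 2) τ / (4 * Real.pi * I) = D4 at *
  generalize thetaDD 0 (2 * τ) / (4 * Real.pi * I) = D3' at *
  generalize thetaDD (1 / 2) (2 * τ) / (4 * Real.pi * I) = D4' at *
  generalize thetaC 0 τ = t2 at *
  generalize jacobiTheta₂ 0 τ = t3 at *
  generalize jacobiTheta₂ (1 / 2) τ = t4 at *
  generalize thetaC 0 (2 * τ) = B at *
  generalize jacobiTheta₂ 0 (2 * τ) = A at *
  generalize jacobiTheta₂ (1 / 2) (2 * τ) = s4 at *
  clear dbl sgl
  obtain ⟨L3, rfl⟩ : ∃ L, D3 = L * t3 := ⟨D3 / t3, by field_simp⟩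
  obtain ⟨L4, rfl⟩ : ∃ L, D4 = L * t4 := ⟨D4 / t4, by field_simp⟩
  obtain ⟨M3, rfl⟩ : ∃ L, D3' = L * A := ⟨D3' / A, by field_simp⟩
  obtain ⟨M4, rfl⟩ : ∃ L, D4' = L * s4 := ⟨D4' / s4, by field_simp⟩
  simp only [Nat.cast_ofNat, Nat.add_one_sub_one, pow_one] at E3 E4
  have hM4 : M4 = (L3 + L4) / 4 := by
    refine mul_right_cancel₀ (mul_ne_zero n3 n4) ?_
    linear_combination E4 / 4 - M4 * q4
  have hM3 : M3 * A ^ 2 * 4 = (A ^ 2 + B ^ 2) * L3 + (A ^ 2 - B ^ 2) * L4 := by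
    linear_combination E3 / 2 + L3 * q3 + L4 * q4'
  rw [mul_div_cancel_right₀ _ n3, mul_div_cancel_right₀ _ n4, mul_div_cancel_right₀ _ m3,
    mul_div_cancel_right₀ _ m4, show t2 ^ 4 = (t2 ^ 2) ^ 2 by ring, q2, hM4]
  field_simp
  linear_combination -4 * hM3

/-- Invariance under τ ↦ 2τ identifies the value with its limit at the cusp. Since θ₃ = 1 + 2q +
o(q), θ₄ = 1 - 2q + o(q) and θ₂⁴ = 16q + o(q), the limit is πi(-2-2)/16. -/
theorem logDerivQuot_eq {τ : ℂ} (hτ : 0 < τ.im) : logDerivQuot τ = -(Real.pi * I / 4) := by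
  have hpi : (Real.pi : ℂ) ≠ 0 := ofReal_ne_zero.mpr Real.pi_ne_zero
  have hconst : ∀ n : ℕ, logDerivQuot (2 ^ n * τ) = logDerivQuot τ := by
    intro n
    induction n with
    | zero => simp
    | succ n ih =>
      rw [← ih, ← logDerivQuot_two_mul (im_two_pow_mul_pos hτ n), pow_succ']
      ring_nf
  -- the quotient as a function of the nome
  let G : ℂ → ℂ := fun q => Real.pi * I *
    (-deriv nomeTheta (-q) / nomeTheta (-q) - deriv nomeTheta q / nomeTheta q) *
      (q⁻¹ * (nomeTheta q ^ 4 - nomeTheta (-q) ^ 4))⁻¹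
  have hG : ∀ {s : ℂ}, 0 < s.im → logDerivQuot s = G (exp (I * Real.pi * s)) := by
    intro s hs
    have hq := norm_nome_lt_one hs
    have dq : HasDerivAt (fun s : ℂ => exp (I * Real.pi * s))
        (exp (I * Real.pi * s) * (I * Real.pi)) s := by
      simpa using ((hasDerivAt_id s).const_mul (I * Real.pi)).cexp
    have d3 := (hasDerivAt_jacobiTheta₂_snd 0 hs).unique
      ((HasDerivAt.comp (h₂ := nomeTheta) s (differentiableAt_nomeTheta hq).hasDerivAt dq).congr_of_eventuallyEq
        ((eventually_im_pos hs).mono fun u hu => jacobiTheta₂_zero_eq_nomeTheta hu))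
    have d4 := (hasDerivAt_jacobiTheta₂_snd (1 / 2) hs).unique
      ((HasDerivAt.comp (h₂ := nomeTheta) (h := fun s => -exp (I * Real.pi * s)) s
        (differentiableAt_nomeTheta (by simpa using hq)).hasDerivAt dq.neg).congr_of_eventuallyEq
        ((eventually_im_pos hs).mono fun u hu => jacobiTheta₂_half_eq_nomeTheta hu))
    rw [logDerivQuot, d3, d4, thetaC_zero_pow_four hs, jacobiTheta₂_zero_eq_nomeTheta hs,
      jacobiTheta₂_half_eq_nomeTheta hs]
    simp only [G, mul_inv, inv_inv, div_eq_mul_inv]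
    ring
  have hlim : Tendsto G (𝓝[≠] 0) (𝓝 (-(Real.pi * I / 4))) := by
    have hφ : ContinuousAt nomeTheta 0 := hasDerivAt_nomeTheta_zero.continuousAt
    have han : AnalyticAt ℂ nomeTheta 0 := by
      refine DifferentiableOn.analyticAt (s := Metric.ball 0 1) (fun q hq => ?_)
        (Metric.ball_mem_nhds _ one_pos)
      exact (differentiableAt_nomeTheta (by simpa using hq)).differentiableWithinAt
    have hd : ContinuousAt (deriv nomeTheta) 0 := han.deriv.continuousAt
    have hneg : ContinuousAt (fun q : ℂ => -q) 0 := continuous_neg.continuousAt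
    have hφn : ContinuousAt (fun q => nomeTheta (-q)) 0 :=
      ContinuousAt.comp (g := nomeTheta) (by rwa [neg_zero]) hneg
    have hdn : ContinuousAt (fun q => deriv nomeTheta (-q)) 0 :=
      ContinuousAt.comp (g := deriv nomeTheta) (by rwa [neg_zero]) hneg
    have h1 : ContinuousAt (fun q => (Real.pi * I : ℂ) *
        (-deriv nomeTheta (-q) / nomeTheta (-q) - deriv nomeTheta q / nomeTheta q)) 0 :=
      continuousAt_const.mul ((hdn.neg.div hφn (by simp [nomeTheta_zero])).sub
        (hd.div hφ (by simp [nomeTheta_zero])))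
    have h2 := hasDerivAt_nomeTheta_quartic.tendsto_slope
    have h3 := (h1.tendsto.mono_left (nhdsWithin_le_nhds (s := {0}ᶜ))).mul
      (h2.inv₀ (by norm_num))
    refine (h3.congr' (Eventually.of_forall fun q => ?_)).trans_eq ?_
    · simp [G, slope_def_field, div_eq_inv_mul, nomeTheta_zero]
    · simp only [neg_zero, nomeTheta_zero, hasDerivAt_nomeTheta_zero.deriv]
      congr 1
      ring
  have h := hlim.comp (tendsto_nome_two_pow hτ)
  refine tendsto_nhds_unique (tendsto_const_nhds.congr fun n => ?_) h
  rw [Function.comp_apply, ← hG (im_two_pow_mul_pos hτ n), hconst]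

/-- The coefficients in `exists_second_log_deriv`. -/
theorem second_log_deriv {τ : ℂ} (hτ : 0 < τ.im) (z : ℂ) :
    jacobiTheta₂ z τ * thetaDD z τ - jacobiTheta₂' z τ ^ 2 =
        thetaDD (1 / 2) τ / jacobiTheta₂ (1 / 2) τ * jacobiTheta₂ z τ ^ 2 -
          Real.pi ^ 2 * thetaC 0 τ ^ 2 * jacobiTheta₂ 0 τ ^ 2 * thetaC z τ ^ 2 ∧
      thetaC z τ * thetaCDD z τ - thetaCD z τ ^ 2 =
        thetaDD (1 / 2) τ / jacobiTheta₂ (1 / 2) τ * thetaC z τ ^ 2 -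
          Real.pi ^ 2 * thetaC 0 τ ^ 2 * jacobiTheta₂ 0 τ ^ 2 * jacobiTheta₂ z τ ^ 2 := by
  have hpi : (Real.pi : ℂ) ≠ 0 := ofReal_ne_zero.mpr Real.pi_ne_zero
  obtain ⟨n2, n3, n4⟩ := theta_constants_ne_zero hτ
  obtain ⟨a, b, hab⟩ := exists_second_log_deriv hτ n4
  -- At z = 1/2 both θ₂ and θ₃' vanish, which isolates a. At z = 0 only θ₃' vanishes, and b then
  -- follows from `logDerivQuot_eq`.
  have ha : thetaDD (1 / 2) τ / jacobiTheta₂ (1 / 2) τ = a := by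
    have := (hab (1 / 2)).1
    rw [jacobiTheta₂'_half, thetaC_half] at this
    field_simp
    refine mul_left_cancel₀ n4 ?_
    linear_combination this
  have hb : b = -(Real.pi ^ 2 * thetaC 0 τ ^ 2 * jacobiTheta₂ 0 τ ^ 2) := by
    have h0 := (hab 0).1
    rw [jacobiTheta₂'_zero] at h0
    have hE := logDerivQuot_eq hτ
    rw [logDerivQuot, div_div _ (4 * Real.pi * I : ℂ), mul_comm (4 * Real.pi * I : ℂ),
      ← div_div, ha] at hE
    field_simp at hE
    refine mul_right_cancel₀ (pow_ne_zero 2 n2) ?_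
    linear_combination (-1 : ℂ) * h0 - jacobiTheta₂ 0 τ * hE +
      jacobiTheta₂ 0 τ ^ 2 * Real.pi ^ 2 * thetaC 0 τ ^ 4 * I_sq
  have := hab z
  rw [ha]
  rw [hb] at this
  constructor
  · linear_combination this.1
  · linear_combination this.2

/-! ### The differential equation of `θ₂ / θ₃` -/

theorem differentiable_thetaC {τ : ℂ} (hτ : 0 < τ.im) : Differentiable ℂ (thetaC · τ) :=
  fun z => (hasDerivAt_thetaC z hτ).differentiableAt

theorem differentiable_thetaCD {τ : ℂ} (hτ : 0 < τ.im) : Differentiable ℂ (thetaCD · τ) :=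
  fun z => (hasDerivAt_thetaCD z hτ).differentiableAt

theorem differentiable_jacobiTheta₂ {τ : ℂ} (hτ : 0 < τ.im) :
    Differentiable ℂ (jacobiTheta₂ · τ) :=
  fun z => (hasDerivAt_jacobiTheta₂_fst z hτ).differentiableAt

theorem differentiable_jacobiTheta₂' {τ : ℂ} (hτ : 0 < τ.im) :
    Differentiable ℂ (jacobiTheta₂' · τ) :=
  fun z => (hasDerivAt_jacobiTheta₂' z hτ).differentiableAt

/-- With f = θ₂/θ₃ the second logarithmic derivatives give (log f)'' = β(f² - f⁻²), so the energy
(log f)'² - β(f² + f⁻²) is constant near 0. Its value is found at z = 0, where the derivatives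
vanish by evenness; the identity theorem removes the restriction on z. -/
theorem wronskian_sq {τ : ℂ} (hτ : 0 < τ.im) (z : ℂ) :
    (thetaCD z τ * jacobiTheta₂ z τ - thetaC z τ * jacobiTheta₂' z τ) ^ 2 =
      Real.pi ^ 2 * (thetaC 0 τ ^ 2 * jacobiTheta₂ z τ ^ 2 - jacobiTheta₂ 0 τ ^ 2 * thetaC z τ ^ 2) *
        (jacobiTheta₂ 0 τ ^ 2 * jacobiTheta₂ z τ ^ 2 - thetaC 0 τ ^ 2 * thetaC z τ ^ 2) := by
  obtain ⟨n2, n3, -⟩ := theta_constants_ne_zero hτ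
  have dC := differentiable_thetaC hτ
  have dC' := differentiable_thetaCD hτ
  have dA := differentiable_jacobiTheta₂ hτ
  have dA' := differentiable_jacobiTheta₂' hτ
  set β : ℂ := Real.pi ^ 2 * thetaC 0 τ ^ 2 * jacobiTheta₂ 0 τ ^ 2 with hβ
  obtain ⟨r, hr, hball⟩ := Metric.eventually_nhds_iff_ball.mp
    ((dC.continuous.continuousAt.eventually_ne n2).and
      (dA.continuous.continuousAt.eventually_ne n3))
  let Φ : ℂ → ℂ := fun z => (thetaCD z τ / thetaC z τ - jacobiTheta₂' z τ / jacobiTheta₂ z τ) ^ 2 -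
    β * ((thetaC z τ / jacobiTheta₂ z τ) ^ 2 + (jacobiTheta₂ z τ / thetaC z τ) ^ 2)
  have hΦ : ∀ w ∈ Metric.ball (0 : ℂ) r, HasDerivAt Φ 0 w := by
    intro w hw
    obtain ⟨c0, a0⟩ := hball w hw
    have hC := hasDerivAt_thetaC w hτ
    have hC' := hasDerivAt_thetaCD w hτ
    have hA := hasDerivAt_jacobiTheta₂_fst w hτ
    have hA' := hasDerivAt_jacobiTheta₂' w hτ
    obtain ⟨s1, s2⟩ := second_log_deriv hτ w
    rw [← hβ] at s1 s2
    refine ((((hC'.div hC c0).sub (hA'.div hA a0)).pow 2).sub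
      ((((hC.div hA a0).pow 2).add ((hA.div hC c0).pow 2)).const_mul β)).congr_deriv ?_
    generalize thetaDD (1 / 2) τ / jacobiTheta₂ (1 / 2) τ = a at s1 s2
    have e1 : thetaDD w τ = (a * jacobiTheta₂ w τ ^ 2 - β * thetaC w τ ^ 2 +
        jacobiTheta₂' w τ ^ 2) / jacobiTheta₂ w τ := by
      rw [eq_div_iff a0]
      linear_combination s1
    have e2 : thetaCDD w τ = (a * thetaC w τ ^ 2 - β * jacobiTheta₂ w τ ^ 2 +
        thetaCD w τ ^ 2) / thetaC w τ := by
      rw [eq_div_iff c0]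
      linear_combination s2
    simp only [e1, e2, Pi.sub_apply, Pi.div_apply]
    push_cast
    simp only [pow_one]
    field_simp
    ring
  have hconst : ∀ w ∈ Metric.ball (0 : ℂ) r, Φ w = Φ 0 := fun w hw =>
    Metric.isOpen_ball.is_const_of_deriv_eq_zero (convex_ball (0 : ℂ) r).isPreconnected
      (fun u hu => (hΦ u hu).differentiableAt.differentiableWithinAt)
      (fun u hu => (hΦ u hu).deriv) hw (Metric.mem_ball_self hr)
  have hΦ0 : Φ 0 = -β * ((thetaC 0 τ / jacobiTheta₂ 0 τ) ^ 2 +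
      (jacobiTheta₂ 0 τ / thetaC 0 τ) ^ 2) := by
    simp only [Φ, thetaCD_zero hτ, jacobiTheta₂'_zero]
    ring
  have hL : AnalyticOnNhd ℂ
      (fun z => (thetaCD z τ * jacobiTheta₂ z τ - thetaC z τ * jacobiTheta₂' z τ) ^ 2) Set.univ :=
    (((dC'.mul dA).sub (dC.mul dA')).pow 2).differentiableOn.analyticOnNhd isOpen_univ
  have hR : AnalyticOnNhd ℂ (fun z => Real.pi ^ 2 *
      (thetaC 0 τ ^ 2 * jacobiTheta₂ z τ ^ 2 - jacobiTheta₂ 0 τ ^ 2 * thetaC z τ ^ 2) *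
        (jacobiTheta₂ 0 τ ^ 2 * jacobiTheta₂ z τ ^ 2 - thetaC 0 τ ^ 2 * thetaC z τ ^ 2)) Set.univ :=
    (((((dA.pow 2).const_mul _).sub ((dC.pow 2).const_mul _)).const_mul _).mul
      (((dA.pow 2).const_mul _).sub ((dC.pow 2).const_mul _))).differentiableOn.analyticOnNhd
      isOpen_univ
  refine congrFun (hL.eq_of_eventuallyEq hR (z₀ := 0) ?_) z
  filter_upwards [Metric.ball_mem_nhds (0 : ℂ) hr] with w hw
  obtain ⟨c0, a0⟩ := hball w hw
  have h := hconst w hw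
  rw [hΦ0, hβ] at h
  simp only [Φ] at h
  rw [hβ] at h
  field_simp at h
  linear_combination h

/-! ### The modular function `λ` -/

/-- `λ(τ) = θ₂⁴ / θ₃⁴`. -/
def modLambda (τ : ℂ) : ℂ := thetaC 0 τ ^ 4 / jacobiTheta₂ 0 τ ^ 4

theorem one_sub_modLambda {τ : ℂ} (hτ : 0 < τ.im) :
    1 - modLambda τ = jacobiTheta₂ (1 / 2) τ ^ 4 / jacobiTheta₂ 0 τ ^ 4 := by
  have n3 := (theta_constants_ne_zero hτ).2.1
  rw [modLambda, eq_div_iff (pow_ne_zero 4 n3), sub_mul, div_mul_cancel₀ _ (pow_ne_zero 4 n3),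
    theta_quartic hτ]
  ring

/-- Written as 1 - (θ₄/θ₃)⁴, the function has its derivative determined by `logDerivQuot_eq`. -/
theorem hasDerivAt_modLambda {τ : ℂ} (hτ : 0 < τ.im) :
    HasDerivAt modLambda (I * Real.pi * thetaC 0 τ ^ 4 * jacobiTheta₂ (1 / 2) τ ^ 4 /
      jacobiTheta₂ 0 τ ^ 4) τ := by
  obtain ⟨n2, n3, n4⟩ := theta_constants_ne_zero hτ
  have h := (((hasDerivAt_jacobiTheta₂_snd (1 / 2) hτ).pow 4).div
    ((hasDerivAt_jacobiTheta₂_snd 0 hτ).pow 4) (pow_ne_zero 4 n3)).const_sub 1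
  have h' := h.congr_of_eventuallyEq (f₁ := modLambda) ((eventually_im_pos hτ).mono fun s hs => by
    have := one_sub_modLambda hs
    simp only [Pi.div_apply, Pi.pow_apply]
    rw [← this]
    ring)
  refine h'.congr_deriv ?_
  have hE := logDerivQuot_eq hτ
  rw [logDerivQuot, div_eq_iff (pow_ne_zero 4 n2)] at hE
  generalize thetaDD (1 / 2) τ / (4 * Real.pi * I) = D4 at *
  generalize thetaDD 0 τ / (4 * Real.pi * I) = D3 at *
  simp only [Pi.pow_apply]
  push_cast
  field_simp at hE ⊢
  linear_combination -hE

theorem thetaC_zero_S {τ : ℂ} (hτ : 0 < τ.im) :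
    jacobiTheta₂ (1 / 2) τ = 1 / (-I * τ) ^ (1 / 2 : ℂ) * thetaC 0 (-1 / τ) := by
  have h0 : τ ≠ 0 := fun h => by simp [h] at hτ
  rw [jacobiTheta₂_functional_equation, thetaC, ← jacobiTheta₂_neg_left, mul_assoc]
  congr 3
  · field_simp
    ring
  · field_simp
    ring

/-- The inversion τ ↦ -1/τ exchanges θ₂ and θ₄ and fixes θ₃, all up to the same factor, which
cancels in the quotient. -/
theorem modLambda_S {τ : ℂ} (hτ : 0 < τ.im) : modLambda (-1 / τ) = 1 - modLambda τ := by
  have h0 : τ ≠ 0 := fun h => by simp [h] at hτ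
  have h1 : 1 / (-I * τ) ^ (1 / 2 : ℂ) ≠ 0 := by
    simp [cpow_eq_zero_iff, h0]
  rw [one_sub_modLambda hτ, thetaC_zero_S hτ, jacobiTheta₂_functional_equation 0 τ, modLambda]
  simp only [ne_eq, OfNat.ofNat_ne_zero, not_false_eq_true, zero_pow, mul_zero, zero_div, exp_zero,
    mul_one]
  rw [mul_pow, mul_pow, mul_div_mul_left _ _ (pow_ne_zero 4 h1)]

theorem jacobiTheta₂_zero_S_sq {τ : ℂ} (hτ : 0 < τ.im) :
    jacobiTheta₂ 0 (-1 / τ) ^ 2 = -I * τ * jacobiTheta₂ 0 τ ^ 2 := by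
  have h0 : τ ≠ 0 := fun h => by simp [h] at hτ
  have h1 : (-I * τ) ≠ 0 := by simp [h0]
  rw [jacobiTheta₂_functional_equation 0 τ]
  simp only [ne_eq, OfNat.ofNat_ne_zero, not_false_eq_true, zero_pow, mul_zero, zero_div, exp_zero,
    mul_one]
  rw [mul_pow, one_div, inv_pow, ← cpow_nat_mul, show ((2 : ℕ) : ℂ) * (1 / 2) = 1 by norm_num,
    cpow_one, ← mul_assoc, mul_inv_cancel₀ h1, one_mul]

/-! ### Theta functions of real argument for purely imaginary `τ` -/

theorem abs_cos_odd_mul_le (n : ℕ) (x : ℝ) :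
    |Real.cos ((2 * n + 1) * x)| ≤ (2 * n + 1) * |Real.cos x| := by
  induction n with
  | zero => simp
  | succ n ih =>
    have e : (2 * ((n + 1 : ℕ) : ℝ) + 1) * x = (2 * n + 1) * x + 2 * x := by
      push_cast
      ring
    rw [e, Real.cos_add, Real.sin_two_mul]
    have h1 : |Real.cos ((2 * n + 1) * x) * Real.cos (2 * x)| ≤ (2 * n + 1) * |Real.cos x| := by
      rw [abs_mul]
      calc _ ≤ |Real.cos ((2 * n + 1) * x)| * 1 :=
            mul_le_mul_of_nonneg_left (Real.abs_cos_le_one _) (abs_nonneg _)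
        _ ≤ _ := by rw [mul_one]; exact ih
    have h2 : |Real.sin ((2 * n + 1) * x) * (2 * Real.sin x * Real.cos x)| ≤ 2 * |Real.cos x| := by
      rw [abs_mul, abs_mul, abs_mul, abs_two]
      have a1 := Real.abs_sin_le_one ((2 * n + 1) * x)
      have a2 := Real.abs_sin_le_one x
      have a3 := mul_le_one₀ a1 (abs_nonneg (Real.sin x)) a2
      nlinarith [abs_nonneg (Real.cos x)]
    refine (abs_sub _ _).trans ?_
    push_cast
    linarith

theorem hasSum_thetaC_cos (z : ℂ) {τ : ℂ} (hτ : 0 < τ.im) :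
    HasSum (fun n : ℕ => 2 * exp (I * Real.pi * τ * (n + 1 / 2) ^ 2) *
      cos ((2 * n + 1) * (Real.pi * z))) (thetaC z τ) := by
  convert! (hasSum_thetaC z hτ).nat_add_neg_add_one using 1
  funext n
  have h : ∀ u v : ℂ, 2 * u * cos v = u * exp (v * I) + u * exp (-v * I) := fun u v => by
    rw [cos]
    ring
  rw [h, jacobiTheta₂_term, jacobiTheta₂_term, ← exp_add, ← exp_add, ← exp_add, ← exp_add]
  congr 2
  · push_cast
    ring
  · push_cast
    ring

/-- The first term of the cosine series dominates. Relative to it, the n-th term is at most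
(2n+1)e^{-πsn(n+1)} ≤ (3/16)ⁿ, because s > 1/2 gives e^{-2πs} ≤ 1/16; the tail is at most 3/13 of
the first term. -/
theorem thetaC_ne_zero_of_cos_ne_zero {s : ℝ} (hs : 1 / 2 < s) {z : ℝ}
    (hz : Real.cos (Real.pi * z) ≠ 0) : thetaC z (I * s) ≠ 0 := by
  have hτ : 0 < (I * (s : ℂ)).im := by simp; linarith
  have hsum := hasSum_thetaC_cos z hτ
  have hterm : ∀ n : ℕ, 2 * exp (I * Real.pi * (I * s) * (n + 1 / 2) ^ 2) *
      cos ((2 * n + 1) * (Real.pi * z)) =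
      ((2 * Real.exp (-Real.pi * s * (n + 1 / 2) ^ 2) *
        Real.cos ((2 * n + 1) * (Real.pi * z)) : ℝ) : ℂ) := by
    intro n
    push_cast
    congr 3
    linear_combination (Real.pi * s * (n + 1 / 2) ^ 2 : ℂ) * I_sq
  simp only [hterm] at hsum
  intro h0
  rw [h0, ← ofReal_zero, Complex.hasSum_ofReal, ← hasSum_nat_add_iff' 1] at hsum
  simp only [Finset.range_one, Finset.sum_singleton, Nat.cast_zero, mul_zero, zero_add, one_mul,
    zero_sub] at hsum
  set M := 2 * Real.exp (-Real.pi * s * (1 / 2) ^ 2) * |Real.cos (Real.pi * z)| with hM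
  have hMpos : 0 < M := by positivity
  have hexp : Real.exp (-(2 * Real.pi * s)) ≤ 1 / 16 := by
    have h3 : (3 : ℝ) ≤ 2 * Real.pi * s := by nlinarith [Real.pi_gt_three]
    have h4 : (16 : ℝ) ≤ Real.exp 3 := by
      have := Real.exp_one_gt_d9
      have e : Real.exp 3 = Real.exp 1 ^ 3 := by rw [← Real.exp_nat_mul]; norm_num
      rw [e]
      calc (16 : ℝ) ≤ 2.7 ^ 3 := by norm_num
        _ ≤ _ := pow_le_pow_left₀ (by norm_num) (by linarith) 3
    rw [Real.exp_neg, one_div]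
    exact inv_anti₀ (by norm_num) (h4.trans (Real.exp_le_exp.mpr h3))
  have hbd : ∀ n : ℕ, ‖2 * Real.exp (-Real.pi * s * (((n + 1 : ℕ) : ℝ) + 1 / 2) ^ 2) *
      Real.cos ((2 * ((n + 1 : ℕ) : ℝ) + 1) * (Real.pi * z))‖ ≤ M * (3 / 16) * (3 / 16) ^ n := by
    intro n
    have h1 := abs_cos_odd_mul_le (n + 1) (Real.pi * z)
    have h2 : (2 * ((n + 1 : ℕ) : ℝ) + 1) ≤ 3 ^ (n + 1) := by
      have := one_add_mul_le_pow (show (-2 : ℝ) ≤ 2 by norm_num) (n + 1)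
      norm_num at this ⊢
      linarith
    have h3 : Real.exp (-Real.pi * s * (((n + 1 : ℕ) : ℝ) + 1 / 2) ^ 2) ≤
        Real.exp (-Real.pi * s * (1 / 2) ^ 2) * (1 / 16) ^ (n + 1) := by
      calc _ ≤ Real.exp (-Real.pi * s * (1 / 2) ^ 2 + (n + 1 : ℕ) * (-(2 * Real.pi * s))) := by
            refine Real.exp_le_exp.mpr ?_
            have hps : 0 < Real.pi * s := mul_pos Real.pi_pos (by linarith)
            have hn : (0 : ℝ) ≤ n := n.cast_nonneg
            push_cast
            nlinarith [mul_nonneg hps.le hn, mul_nonneg hps.le (mul_nonneg hn hn)]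
        _ ≤ _ := by
            rw [Real.exp_add, Real.exp_nat_mul]
            gcongr
    rw [Real.norm_eq_abs, abs_mul, abs_of_pos (by positivity)]
    calc _ ≤ 2 * (Real.exp (-Real.pi * s * (1 / 2) ^ 2) * (1 / 16) ^ (n + 1)) *
          (3 ^ (n + 1) * |Real.cos (Real.pi * z)|) := by
          gcongr
          exact h1.trans (by gcongr)
      _ = M * (3 / 16) * (3 / 16) ^ n := by
          rw [hM, show (3 / 16 : ℝ) = 1 / 16 * 3 by norm_num, mul_pow]
          ring
  have hg := (hasSum_geometric_of_lt_one (r := (3 / 16 : ℝ)) (by norm_num) (by norm_num)).mul_left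
    (M * (3 / 16))
  have hle := hsum.norm_le_of_bounded hg hbd
  rw [norm_neg, Real.norm_eq_abs, abs_mul, abs_of_pos (by positivity), ← hM] at hle
  norm_num at hle
  linarith

theorem exists_real_restriction {e e' : ℂ → ℂ} (h : ∀ z, HasDerivAt e (e' z) z)
    (hr : ∀ x : ℝ, (starRingEnd ℂ) (e x) = e x) :
    ∃ f f' : ℝ → ℝ, ∀ x : ℝ, e x = f x ∧ e' x = f' x ∧ HasDerivAt f (f' x) x := by
  have hf : ∀ x : ℝ, e x = ((e x).re : ℂ) := fun x => (conj_eq_iff_re.mp (hr x)).symm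
  refine ⟨fun x => (e x).re, fun x => (e' x).re, fun x => ⟨hf x, ?_, (h x).real_of_complex⟩⟩
  have h1 : HasDerivAt (fun x : ℝ => e x) (e' x) x := (h x).comp_ofReal
  have h2 : HasDerivAt (fun x : ℝ => ((e x).re : ℂ)) ((e' x).re : ℂ) x :=
    (h x).real_of_complex.ofReal_comp
  have h3 : (fun x : ℝ => e x) = fun x : ℝ => ((e x).re : ℂ) := funext hf
  rw [h3] at h1
  exact h1.unique h2

theorem conj_jacobiTheta₂_real (s x : ℝ) :
    (starRingEnd ℂ) (jacobiTheta₂ x (I * s)) = jacobiTheta₂ x (I * s) := by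
  rw [jacobiTheta₂_conj]
  simp

theorem conj_thetaC_real (s x : ℝ) :
    (starRingEnd ℂ) (thetaC x (I * s)) = thetaC x (I * s) := by
  conv_rhs => rw [← thetaC_neg, thetaC, ← jacobiTheta₂_neg_left]
  rw [thetaC, map_mul, ← exp_conj, jacobiTheta₂_conj]
  have h4 : (starRingEnd ℂ) 4 = 4 := map_ofNat _ 4
  have h2 : (starRingEnd ℂ) 2 = 2 := map_ofNat _ 2
  congr 2
  · simp [h4]
  · simp [h2]
    ring
  · simp

/-! ### The complete elliptic integral on the imaginary axis -/

theorem ellK_ofReal {t : ℝ} (ht : t < 1) :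
    ellK t = ((∫ φ in (0 : ℝ)..(Real.pi / 2), (1 - t * Real.sin φ ^ 2) ^ (-(1 / 2) : ℝ) : ℝ) : ℂ) := by
  rw [ellK, ← intervalIntegral.integral_ofReal]
  refine intervalIntegral.integral_congr fun φ _ => ?_
  have h : 0 ≤ 1 - t * Real.sin φ ^ 2 := by
    nlinarith [Real.sin_sq_le_one φ, sq_nonneg (Real.sin φ)]
  rw [ofReal_cpow h]
  push_cast
  rfl

/-- If `c` runs from `1` to `0` along `[0, ℓ]` with `c'² = ω² (1 - c²) (1 - t c²)`, then `ω ℓ` is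
the complete elliptic integral of parameter `t`. -/
theorem integral_of_elliptic_ode {t ω ℓ : ℝ} (ht : t < 1) (hω : 0 < ω) (hℓ : 0 < ℓ)
    {c c' : ℝ → ℝ} (hc : ∀ x ∈ Set.Icc 0 ℓ, HasDerivAt c (c' x) x)
    (hc' : ContinuousOn c' (Set.Ioo 0 ℓ)) (h0 : c 0 = 1) (hl : c ℓ = 0)
    (hlt : ∀ x ∈ Set.Ioo 0 ℓ, c x ^ 2 < 1)
    (hode : ∀ x ∈ Set.Ioo 0 ℓ, c' x ^ 2 = ω ^ 2 * (1 - c x ^ 2) * (1 - t * c x ^ 2)) :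
    ∫ φ in (0 : ℝ)..(Real.pi / 2), (1 - t * Real.sin φ ^ 2) ^ (-(1 / 2) : ℝ) = ω * ℓ := by
  have hpos : ∀ y : ℝ, y ^ 2 ≤ 1 → 0 < 1 - t * y ^ 2 := fun y hy => by
    rcases hy.lt_or_eq with h | h
    · nlinarith [mul_nonneg (sub_pos.mpr ht).le (sq_nonneg y)]
    · rw [h]
      linarith
  have hle : ∀ x ∈ Set.Icc 0 ℓ, c x ^ 2 ≤ 1 := by
    intro x hx
    rcases eq_or_lt_of_le hx.1 with h | h
    · simp [← h, h0]
    rcases eq_or_lt_of_le hx.2 with h' | h'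
    · simp [h', hl]
    · exact (hlt x ⟨h, h'⟩).le
  have hcc : ContinuousOn c (Set.Icc 0 ℓ) := fun x hx => (hc x hx).continuousAt.continuousWithinAt
  have hcc' : ContinuousOn c (Set.Ioo 0 ℓ) := hcc.mono Set.Ioo_subset_Icc_self
  have hsqrt : ∀ x ∈ Set.Ioo 0 ℓ, 0 < √(1 - c x ^ 2) := fun x hx =>
    Real.sqrt_pos.mpr (by linarith [hlt x hx])
  have hsqrt' : ∀ x ∈ Set.Ioo 0 ℓ, 0 < √(1 - t * c x ^ 2) := fun x hx =>
    Real.sqrt_pos.mpr (hpos _ (hlt x hx).le)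
  -- The right side of the equation is positive inside the interval, so c' keeps one sign there. The
  -- sign itself is decided at the end by positivity of the integral.
  have hsign : ∃ ε : ℝ, (ε = 1 ∨ ε = -1) ∧
      ∀ x ∈ Set.Ioo 0 ℓ, c' x = ε * (ω * √(1 - c x ^ 2) * √(1 - t * c x ^ 2)) := by
    have := isPreconnected_Ioo.eq_or_eq_neg_of_sq_eq (f := c')
      (g := fun x => ω * √(1 - c x ^ 2) * √(1 - t * c x ^ 2)) hc' (by fun_prop)
      (fun x hx => by
        simp only [Pi.pow_apply]
        rw [hode x hx, mul_pow, mul_pow, Real.sq_sqrt (by linarith [hlt x hx]),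
          Real.sq_sqrt (hpos _ (hlt x hx).le).le])
      (fun {x} hx => (mul_pos (mul_pos hω (hsqrt x hx)) (hsqrt' x hx)).ne')
    rcases this with h | h
    · exact ⟨1, Or.inl rfl, fun x hx => by rw [h hx, one_mul]⟩
    · exact ⟨-1, Or.inr rfl, fun x hx => by rw [h hx, Pi.neg_apply, neg_one_mul]⟩
  obtain ⟨ε, hε, hsgn⟩ := hsign
  let G : ℝ → ℝ := fun φ => (1 - t * Real.sin φ ^ 2) ^ (-(1 / 2) : ℝ)
  have hG : Continuous G := by
    refine Continuous.rpow_const (by fun_prop) fun φ => Or.inl ?_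
    exact (hpos _ (Real.sin_sq_le_one φ)).ne'
  have hGpos : ∀ φ, 0 < G φ := fun φ => Real.rpow_pos_of_pos (hpos _ (Real.sin_sq_le_one φ)) _
  have hφc : ContinuousOn (fun x => Real.arcsin (c x)) (Set.Icc 0 ℓ) :=
    Real.continuous_arcsin.comp_continuousOn hcc
  have hcomp : ∀ x ∈ Set.Icc 0 ℓ, (G ∘ fun x => Real.arcsin (c x)) x *
      (ε * (ω * √(1 - t * c x ^ 2))) = ε * ω := by
    intro x hx
    have h1 := abs_le.mp ((sq_le_one_iff_abs_le_one _).mp (hle x hx))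
    have h2 := hpos _ (hle x hx)
    simp only [Function.comp_apply, G]
    rw [Real.sin_arcsin h1.1 h1.2, Real.rpow_neg h2.le, ← Real.sqrt_eq_rpow]
    have h3 : √(1 - t * c x ^ 2) ≠ 0 := (Real.sqrt_pos.mpr h2).ne'
    field_simp
  have huIcc : Set.uIcc 0 ℓ = Set.Icc 0 ℓ := Set.uIcc_of_le hℓ.le
  -- Substitution φ = arcsin c makes the integrand the constant εω. The form used asks for a
  -- derivative only in the open interval, as arcsin is not differentiable at c(0) = 1.
  have hint := intervalIntegral.integral_comp_mul_deriv''' (a := 0) (b := ℓ)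
    (f := fun x => Real.arcsin (c x)) (f' := fun x => ε * (ω * √(1 - t * c x ^ 2))) (g := G)
    (by rwa [huIcc])
    (fun x hx => by
      rw [min_eq_left hℓ.le, max_eq_right hℓ.le] at hx
      have hx' := Set.Ioo_subset_Icc_self hx
      have h1 := (sq_lt_one_iff_abs_lt_one _).mp (hlt x hx)
      have h2 := abs_lt.mp h1
      have h3 := (Real.hasDerivAt_arcsin h2.1.ne' h2.2.ne).comp x (hc x hx')
      refine (h3.congr_deriv ?_).hasDerivWithinAt
      rw [hsgn x hx]
      have := (hsqrt x hx).ne'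
      field_simp)
    hG.continuousOn
    (by
      rw [huIcc]
      exact hG.continuousOn.integrableOn_compact (isCompact_Icc.image_of_continuousOn hφc))
    (by
      rw [huIcc]
      exact ((continuousOn_const (c := ε * ω)).integrableOn_Icc).congr_fun
        (fun x hx => (hcomp x hx).symm) measurableSet_Icc)
  rw [intervalIntegral.integral_congr (g := fun _ => ε * ω)
    (fun x hx => hcomp x (by rwa [huIcc] at hx)), intervalIntegral.integral_const, h0, hl,
    Real.arcsin_one, Real.arcsin_zero, intervalIntegral.integral_symm, smul_eq_mul, sub_zero] at hint
  have hGint : 0 < ∫ φ in (0 : ℝ)..(Real.pi / 2), G φ :=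
    intervalIntegral.intervalIntegral_pos_of_pos (hG.intervalIntegrable _ _) hGpos
      (by positivity)
  change ∫ φ in (0 : ℝ)..(Real.pi / 2), G φ = ω * ℓ
  rcases hε with h | h
  · rw [h] at hint
    nlinarith [mul_pos hω hℓ]
  · rw [h] at hint
    linarith

/-- `K = (π/2) θ₃²` on the part `Im τ > 1/2` of the imaginary axis. -/
theorem ellK_modLambda_imag {s : ℝ} (hs : 1 / 2 < s) :
    ellK (modLambda (I * s)) = Real.pi / 2 * jacobiTheta₂ 0 (I * s) ^ 2 ∧
      ∃ k : ℝ, 0 < k ∧ k < 1 ∧ modLambda (I * s) = k := by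
  have hτ : 0 < (I * (s : ℂ)).im := by simp; linarith
  obtain ⟨n2, n3, n4⟩ := theta_constants_ne_zero hτ
  obtain ⟨C, C', hC⟩ := exists_real_restriction (fun z => hasDerivAt_thetaC z hτ)
    (conj_thetaC_real s)
  obtain ⟨A, A', hA⟩ := exists_real_restriction (fun z => hasDerivAt_jacobiTheta₂_fst z hτ)
    (conj_jacobiTheta₂_real s)
  have C0 : thetaC 0 (I * s) = C 0 := by simpa using (hC 0).1
  have A0 : jacobiTheta₂ 0 (I * s) = A 0 := by simpa using (hA 0).1
  have A1 : jacobiTheta₂ (1 / 2) (I * s) = A (1 / 2) := by simpa using (hA (1 / 2)).1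
  have C1 : C (1 / 2) = 0 := by
    have := (hC (1 / 2)).1
    push_cast at this
    rw [thetaC_half] at this
    exact_mod_cast this.symm
  rw [C0, ofReal_ne_zero] at n2
  rw [A0, ofReal_ne_zero] at n3
  rw [A1, ofReal_ne_zero] at n4
  have r1 : ∀ x : ℝ, A (1 / 2) ^ 2 * A (x + 1 / 2) ^ 2 = A 0 ^ 2 * A x ^ 2 - C 0 ^ 2 * C x ^ 2 := by
    intro x
    have := jacobiTheta₂_add_half_sq_eq x hτ
    rw [C0, A0, A1, (hC x).1, (hA x).1, show (x : ℂ) + 1 / 2 = ((x + 1 / 2 : ℝ) : ℂ) by push_cast; rfl,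
      (hA _).1] at this
    exact_mod_cast this
  have r2 : ∀ x : ℝ, A (1 / 2) ^ 2 * C (x + 1 / 2) ^ 2 = C 0 ^ 2 * A x ^ 2 - A 0 ^ 2 * C x ^ 2 := by
    intro x
    have := thetaC_add_half_sq_eq x hτ
    rw [C0, A0, A1, (hC x).1, (hA x).1, show (x : ℂ) + 1 / 2 = ((x + 1 / 2 : ℝ) : ℂ) by push_cast; rfl,
      (hC _).1] at this
    exact_mod_cast this
  have r3 : ∀ x : ℝ, (C' x * A x - C x * A' x) ^ 2 = Real.pi ^ 2 *
      (C 0 ^ 2 * A x ^ 2 - A 0 ^ 2 * C x ^ 2) * (A 0 ^ 2 * A x ^ 2 - C 0 ^ 2 * C x ^ 2) := by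
    intro x
    have := wronskian_sq hτ x
    rw [C0, A0, (hC x).1, (hA x).1, (hC x).2.1, (hA x).2.1] at this
    exact_mod_cast this
  have r4 : A 0 ^ 4 = C 0 ^ 4 + A (1 / 2) ^ 4 := by
    have := theta_quartic hτ
    rw [C0, A0, A1] at this
    exact_mod_cast this
  have hCne : ∀ x : ℝ, Real.cos (Real.pi * x) ≠ 0 → C x ≠ 0 := by
    intro x hx h
    have := thetaC_ne_zero_of_cos_ne_zero hs hx
    rw [(hC x).1, h] at this
    simp at this
  have hAne : ∀ x ∈ Set.Icc (0 : ℝ) (1 / 2), A x ≠ 0 := by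
    intro x hx h
    rcases eq_or_lt_of_le hx.2 with h' | h'
    · rw [h'] at h
      exact n4 h
    · have hcos : Real.cos (Real.pi * x) ≠ 0 := by
        refine (Real.cos_pos_of_mem_Ioo ⟨?_, ?_⟩).ne'
        · nlinarith [Real.pi_pos, hx.1]
        · nlinarith [Real.pi_pos]
      have h1 := r1 x
      rw [h] at h1
      have h2 : 0 < C 0 ^ 2 * C x ^ 2 := by
        have := hCne x hcos
        positivity
      nlinarith [sq_nonneg (A (1 / 2) * A (x + 1 / 2))]
  have hk : modLambda (I * s) = ((C 0 ^ 4 / A 0 ^ 4 : ℝ) : ℂ) := by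
    rw [modLambda, C0, A0]
    push_cast
    rfl
  have hA4 : 0 < A 0 ^ 4 := by positivity
  have hk0 : 0 < C 0 ^ 4 / A 0 ^ 4 := by positivity
  have hk1 : C 0 ^ 4 / A 0 ^ 4 < 1 := by
    rw [div_lt_one hA4]
    have : 0 < A (1 / 2) ^ 4 := by positivity
    linarith
  refine ⟨?_, _, hk0, hk1, hk⟩
  rw [hk, ellK_ofReal hk1, A0]
  have hone : ∀ x ∈ Set.Icc (0 : ℝ) (1 / 2), 1 - (C x * A 0 / (A x * C 0)) ^ 2 =
      (C 0 ^ 2 * A x ^ 2 - A 0 ^ 2 * C x ^ 2) / (A x ^ 2 * C 0 ^ 2) := by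
    intro x hx
    have := hAne x hx
    field_simp
  -- The curve is cn/dn written with theta functions. It falls from 1 at z = 0 to 0 at z = 1/2, the
  -- zero of θ₂, with ω = πθ₃(0)².
  rw [integral_of_elliptic_ode (ω := Real.pi * A 0 ^ 2) (ℓ := 1 / 2) hk1 (by positivity)
    (by norm_num) (c := fun x => C x * A 0 / (A x * C 0))
    (c' := fun x => A 0 / C 0 * ((C' x * A x - C x * A' x) / A x ^ 2))]
  · push_cast
    ring
  · intro x hx
    have hx0 := hAne x hx
    refine ((((hC x).2.2.mul_const (A 0)).div ((hA x).2.2.mul_const (C 0))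
      (mul_ne_zero hx0 n2))).congr_deriv ?_
    field_simp
  · have cA : ContinuousOn A (Set.Ioo 0 (1 / 2)) :=
      fun x _ => (hA x).2.2.continuousAt.continuousWithinAt
    have cC : ContinuousOn C (Set.Ioo 0 (1 / 2)) :=
      fun x _ => (hC x).2.2.continuousAt.continuousWithinAt
    have cA' : Continuous A' := by
      have h : (fun x : ℝ => (jacobiTheta₂' x (I * s)).re) = A' :=
        funext fun x => by rw [(hA x).2.1, ofReal_re]
      rw [← h]
      exact continuous_re.comp ((differentiable_jacobiTheta₂' hτ).continuous.comp continuous_ofReal)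
    have cC' : Continuous C' := by
      have h : (fun x : ℝ => (thetaCD x (I * s)).re) = C' :=
        funext fun x => by rw [(hC x).2.1, ofReal_re]
      rw [← h]
      exact continuous_re.comp ((differentiable_thetaCD hτ).continuous.comp continuous_ofReal)
    exact continuousOn_const.mul (((cC'.continuousOn.mul cA).sub (cC.mul cA'.continuousOn)).div
      (cA.pow 2) fun x hx => pow_ne_zero 2 (hAne x (Set.Ioo_subset_Icc_self hx)))
  · field_simp
  · simp only [C1, zero_mul, zero_div]
  · intro x hx
    have hx' := Set.Ioo_subset_Icc_self hx
    have hx0 := hAne x hx'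
    have hcos : Real.cos (Real.pi * (x + 1 / 2)) ≠ 0 := by
      rw [show Real.pi * (x + 1 / 2) = Real.pi * x + Real.pi / 2 by ring, Real.cos_add_pi_div_two,
        neg_ne_zero]
      refine (Real.sin_pos_of_pos_of_lt_pi ?_ ?_).ne'
      · exact mul_pos Real.pi_pos hx.1
      · nlinarith [Real.pi_pos, hx.2]
    have h1 := hCne _ hcos
    have h2 := hone x hx'
    rw [← r2] at h2
    have h3 : 0 < A (1 / 2) ^ 2 * C (x + 1 / 2) ^ 2 / (A x ^ 2 * C 0 ^ 2) := by positivity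
    linarith
  · intro x hx
    have hx0 := hAne x (Set.Ioo_subset_Icc_self hx)
    rw [mul_pow, div_pow, div_pow, r3]
    field_simp

/-! ### The cut plane -/

theorem isOpen_cutPlane : IsOpen cutPlane :=
  isOpen_slitPlane.inter (isOpen_slitPlane.preimage (continuous_const.sub continuous_id))

theorem starConvex_cutPlane : StarConvex ℝ ((1 / 2 : ℝ) : ℂ) cutPlane := by
  have h := starConvex_ofReal_slitPlane (x := 1 / 2) (by norm_num)
  intro t ht a b ha hb hab
  refine ⟨h ht.1 ha hb hab, ?_⟩
  have h2 := h ht.2 ha hb hab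
  have hab' : (a : ℂ) + b = 1 := by exact_mod_cast hab
  convert! h2 using 1
  simp only [real_smul]
  push_cast
  linear_combination -hab'

theorem isPreconnected_cutPlane : IsPreconnected cutPlane :=
  (starConvex_cutPlane.isPathConnected (by
    have h : ((1 / 2 : ℝ) : ℂ) ∈ slitPlane := ofReal_mem_slitPlane.mpr (by norm_num)
    refine ⟨h, ?_⟩
    rwa [show (1 - ((1 / 2 : ℝ) : ℂ)) = ((1 / 2 : ℝ) : ℂ) by push_cast; norm_num])
    ).isConnected.isPreconnected

theorem one_sub_mem_cutPlane {t : ℂ} (ht : t ∈ cutPlane) : 1 - t ∈ cutPlane :=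
  ⟨ht.2, by simpa using ht.1⟩

theorem one_sub_mul_mem_slitPlane {t : ℂ} (ht : 1 - t ∈ slitPlane) {u : ℝ} (h0 : 0 ≤ u)
    (h1 : u ≤ 1) : 1 - t * u ∈ slitPlane := by
  have := starConvex_one_slitPlane ht (sub_nonneg.mpr h1) h0 (by ring)
  convert! this using 1
  simp only [real_smul]
  push_cast
  ring

/-! ### Holomorphy of the complete elliptic integral -/

theorem one_sub_mul_sin_sq_mem {t : ℂ} (ht : 1 - t ∈ slitPlane) (φ : ℝ) :
    1 - t * ((Real.sin φ : ℝ) : ℂ) ^ 2 ∈ slitPlane := by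
  have := one_sub_mul_mem_slitPlane ht (sq_nonneg (Real.sin φ)) (Real.sin_sq_le_one φ)
  push_cast at this ⊢
  exact this

theorem continuous_ellK_integrand {t : ℂ} (ht : 1 - t ∈ slitPlane) :
    Continuous fun φ : ℝ => (1 - t * ((Real.sin φ : ℝ) : ℂ) ^ 2) ^ (-(1 / 2) : ℂ) := by
  refine Continuous.cpow (by fun_prop) continuous_const fun φ => one_sub_mul_sin_sq_mem ht φ

theorem differentiableAt_ellK {t : ℂ} (ht : 1 - t ∈ slitPlane) : DifferentiableAt ℂ ellK t := by
  have hO : IsOpen {t : ℂ | 1 - t ∈ slitPlane} :=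
    isOpen_slitPlane.preimage (continuous_const.sub continuous_id)
  obtain ⟨r, hr, hball⟩ := Metric.nhds_basis_closedBall.mem_iff.mp (hO.mem_nhds ht)
  let F' : ℂ → ℝ → ℂ := fun s φ => -(1 / 2) *
    (1 - s * ((Real.sin φ : ℝ) : ℂ) ^ 2) ^ (-(1 / 2) - 1 : ℂ) * -((Real.sin φ : ℝ) : ℂ) ^ 2
  have hd : ∀ s : ℂ, 1 - s ∈ slitPlane → ∀ φ : ℝ, HasDerivAt
      (fun s => (1 - s * ((Real.sin φ : ℝ) : ℂ) ^ 2) ^ (-(1 / 2) : ℂ)) (F' s φ) s := by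
    intro s hs φ
    have h := (((hasDerivAt_id s).mul_const (((Real.sin φ : ℝ) : ℂ) ^ 2)).const_sub 1).cpow_const
      (c := -(1 / 2)) (one_sub_mul_sin_sq_mem hs φ)
    refine h.congr_deriv ?_
    simp [F']
  have hcont : ContinuousOn (fun p : ℂ × ℝ => F' p.1 p.2)
      (Metric.closedBall t r ×ˢ Set.uIcc 0 (Real.pi / 2)) := by
    refine (continuousOn_const.mul ?_).mul (by fun_prop)
    refine ContinuousOn.cpow (by fun_prop) continuousOn_const fun p hp => ?_
    exact one_sub_mul_sin_sq_mem (hball hp.1) _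
  obtain ⟨M, hM⟩ := ((isCompact_closedBall t r).prod isCompact_uIcc).exists_bound_of_continuousOn
    hcont
  have hcontF : Continuous (F' t) := by
    refine (continuous_const.mul ?_).mul (by fun_prop)
    exact Continuous.cpow (by fun_prop) continuous_const fun φ => one_sub_mul_sin_sq_mem ht φ
  have key := intervalIntegral.hasDerivAt_integral_of_dominated_loc_of_deriv_le
    (μ := MeasureTheory.volume) (a := 0) (b := Real.pi / 2) (bound := fun _ => M)
    (F := fun s φ => (1 - s * ((Real.sin φ : ℝ) : ℂ) ^ 2) ^ (-(1 / 2) : ℂ)) (F' := F')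
    (Metric.ball_mem_nhds t hr)
    (by
      filter_upwards [hO.mem_nhds ht] with s hs
      exact (continuous_ellK_integrand hs).aestronglyMeasurable)
    ((continuous_ellK_integrand ht).intervalIntegrable _ _)
    hcontF.aestronglyMeasurable
    (Eventually.of_forall fun φ hφ s hs =>
      hM (s, φ) ⟨Metric.ball_subset_closedBall hs, Set.uIoc_subset_uIcc hφ⟩)
    (by simp)
    (Eventually.of_forall fun φ _ s hs => hd s (hball (Metric.ball_subset_closedBall hs)) φ)
  exact key.2.differentiableAt

/-! ### Positivity of `Im τ` -/

/-- The exponent -1/2 halves the difference of arguments, leaving it below π/2. -/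
theorem re_cpow_mul_conj_cpow_pos {a b : ℂ} (ha : a ∈ slitPlane) (hb : b ∈ slitPlane)
    (h : |a.arg - b.arg| < Real.pi) :
    0 < (a ^ (-(1 / 2) : ℂ) * (starRingEnd ℂ) (b ^ (-(1 / 2) : ℂ))).re := by
  rw [cpow_def_of_ne_zero (slitPlane_ne_zero ha), cpow_def_of_ne_zero (slitPlane_ne_zero hb),
    ← exp_conj, ← exp_add, exp_re]
  refine mul_pos (Real.exp_pos _) (Real.cos_pos_of_mem_Ioo ?_)
  have him : (log a * -(1 / 2) + (starRingEnd ℂ) (log b * -(1 / 2))).im =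
      -(a.arg - b.arg) / 2 := by
    have : (-(1 / 2) : ℂ) = ((-(1 / 2) : ℝ) : ℂ) := by push_cast; rfl
    rw [this, map_mul, conj_ofReal, add_im, im_mul_ofReal, im_mul_ofReal, conj_im, log_im, log_im]
    ring
  rw [him]
  obtain ⟨h1, h2⟩ := abs_lt.mp h
  constructor <;> linarith

/-- Let a, b be the two bases. For Im t ≥ 0 they lie in the closed upper and lower half planes, and
Im(a·conj b) = Im t·(u + w - uw). When this is positive, arg a - arg b < π; when it is zero, both
bases are positive reals. -/
theorem re_integrand_mul_conj_pos_of_im_nonneg {t : ℂ} (ht : t ∈ cutPlane) (hi : 0 ≤ t.im)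
    {u w : ℝ} (hu0 : 0 ≤ u) (hu1 : u ≤ 1) (hw0 : 0 ≤ w) (hw1 : w ≤ 1) :
    0 < ((1 - (1 - t) * u) ^ (-(1 / 2) : ℂ) *
      (starRingEnd ℂ) ((1 - t * w) ^ (-(1 / 2) : ℂ))).re := by
  have ha := one_sub_mul_mem_slitPlane (one_sub_mem_cutPlane ht).2 hu0 hu1
  have hb := one_sub_mul_mem_slitPlane ht.2 hw0 hw1
  refine re_cpow_mul_conj_cpow_pos ha hb ?_
  have haim : (1 - (1 - t) * u : ℂ).im = u * t.im := by simp; ring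
  have hare : (1 - (1 - t) * u : ℂ).re = 1 - (1 - t.re) * u := by simp
  have hbim : (1 - t * w : ℂ).im = -(w * t.im) := by simp; ring
  have hbre : (1 - t * w : ℂ).re = 1 - t.re * w := by simp
  generalize (1 - (1 - t) * u : ℂ) = a at *
  generalize (1 - t * w : ℂ) = b at *
  have hwu : 0 ≤ w * (1 - u) := mul_nonneg hw0 (by linarith)
  rcases eq_or_lt_of_le (mul_nonneg hi (by linarith : 0 ≤ u + w * (1 - u))) with h0 | h0
  · have hz : u * t.im = 0 ∧ w * t.im = 0 := by
      rcases mul_eq_zero.mp h0.symm with h | h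
      · simp [h]
      · have hu : u = 0 := by linarith
        subst hu
        simp at h
        simp [h]
    have hpos : ∀ {c : ℂ}, c ∈ slitPlane → c.im = 0 → c.arg = 0 := fun {c} hc him => by
      rcases hc with hc | hc
      · exact arg_eq_zero_iff.mpr ⟨hc.le, him⟩
      · exact absurd him hc
    rw [hpos ha (by rw [haim, hz.1]), hpos hb (by rw [hbim, hz.2, neg_zero]), sub_self, abs_zero]
    exact Real.pi_pos
  · have a1 : 0 ≤ a.arg := arg_nonneg_iff.mpr (by rw [haim]; positivity)
    have a2 := arg_le_pi a
    have b1 : b.arg ≤ 0 := by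
      rcases eq_or_lt_of_le (mul_nonneg hw0 hi) with h | h
      · have hb0 : b.im = 0 := by rw [hbim, ← h, neg_zero]
        rcases hb with hb | hb
        · exact (arg_eq_zero_iff.mpr ⟨hb.le, hb0⟩).le
        · exact absurd hb0 hb
      · exact (arg_neg_iff.mpr (by rw [hbim]; linarith)).le
    have b2 := neg_pi_lt_arg b
    have hsin : 0 < Real.sin (a.arg - b.arg) := by
      rw [Real.sin_sub, sin_arg, sin_arg, cos_arg (slitPlane_ne_zero ha),
        cos_arg (slitPlane_ne_zero hb), haim, hare, hbim, hbre]
      have na := norm_pos_iff.mpr (slitPlane_ne_zero ha)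
      have nb := norm_pos_iff.mpr (slitPlane_ne_zero hb)
      have : u * t.im / ‖a‖ * ((1 - t.re * w) / ‖b‖) -
          (1 - (1 - t.re) * u) / ‖a‖ * (-(w * t.im) / ‖b‖) =
          t.im * (u + w * (1 - u)) / (‖a‖ * ‖b‖) := by
        field_simp
        ring
      rw [this]
      positivity
    rw [abs_of_nonneg (by linarith)]
    by_contra hcon
    have := Real.sin_nonpos_of_nonpos_of_neg_pi_le (x := a.arg - b.arg - 2 * Real.pi)
      (by linarith) (by linarith [not_lt.mp hcon])
    rw [Real.sin_sub_two_pi] at this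
    linarith

theorem re_integrand_mul_conj_pos {t : ℂ} (ht : t ∈ cutPlane)
    {u w : ℝ} (hu0 : 0 ≤ u) (hu1 : u ≤ 1) (hw0 : 0 ≤ w) (hw1 : w ≤ 1) :
    0 < ((1 - (1 - t) * u) ^ (-(1 / 2) : ℂ) *
      (starRingEnd ℂ) ((1 - t * w) ^ (-(1 / 2) : ℂ))).re := by
  rcases le_total 0 t.im with h | h
  · exact re_integrand_mul_conj_pos_of_im_nonneg ht h hu0 hu1 hw0 hw1
  · have := re_integrand_mul_conj_pos_of_im_nonneg (one_sub_mem_cutPlane ht) (by simpa using h)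
      hw0 hw1 hu0 hu1
    rw [sub_sub_cancel, ← conj_re, map_mul, conj_conj, mul_comm] at this
    exact this

theorem re_integral_mul_pos {f : ℝ → ℂ} (hf : Continuous f) {w : ℂ} {a b : ℝ} (hab : a < b)
    (h : ∀ x, 0 < (f x * w).re) : 0 < ((∫ x in a..b, f x) * w).re := by
  rw [← intervalIntegral.integral_mul_const]
  have hi : IntervalIntegrable (fun x => f x * w) MeasureTheory.volume a b :=
    (hf.mul continuous_const).intervalIntegrable _ _
  have := reCLM.intervalIntegral_comp_comm hi
  rw [reCLM_apply] at this
  rw [← this]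
  exact intervalIntegral.intervalIntegral_pos_of_pos
    ((continuous_re.comp (hf.mul continuous_const)).intervalIntegrable _ _) h hab

/-- K(1-t)·conj K(t) is a double integral whose integrand has positive real part. This yields both
K(t) ≠ 0 and Im τ > 0. -/
theorem re_ellK_mul_conj_pos {t : ℂ} (ht : t ∈ cutPlane) :
    0 < (ellK (1 - t) * (starRingEnd ℂ) (ellK t)).re := by
  have ht' := one_sub_mem_cutPlane ht
  have hpi : (0 : ℝ) < Real.pi / 2 := by positivity
  refine re_integral_mul_pos (continuous_ellK_integrand ht'.2) hpi fun φ => ?_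
  rw [← conj_re, map_mul, conj_conj, mul_comm]
  refine re_integral_mul_pos (continuous_ellK_integrand ht.2) hpi fun ψ => ?_
  rw [← conj_re, map_mul, conj_conj, mul_comm]
  have := re_integrand_mul_conj_pos ht (sq_nonneg (Real.sin φ)) (Real.sin_sq_le_one φ)
    (sq_nonneg (Real.sin ψ)) (Real.sin_sq_le_one ψ)
  push_cast at this ⊢
  exact this

theorem ellK_ne_zero {t : ℂ} (ht : t ∈ cutPlane) : ellK t ≠ 0 := by
  intro h
  have := re_ellK_mul_conj_pos ht
  simp [h] at this

theorem im_tauOf_pos {t : ℂ} (ht : t ∈ cutPlane) : 0 < (tauOf t).im := by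
  have h0 := ellK_ne_zero ht
  have h1 : tauOf t = I * (ellK (1 - t) * (starRingEnd ℂ) (ellK t)) / ((normSq (ellK t) : ℝ) : ℂ) := by
    have h2 : (starRingEnd ℂ) (ellK t) ≠ 0 := by simpa using h0
    rw [tauOf, normSq_eq_conj_mul_self]
    field_simp
  rw [h1, div_ofReal_im, I_mul_im]
  exact div_pos (re_ellK_mul_conj_pos ht) (normSq_pos.mpr h0)

theorem differentiableAt_tauOf {t : ℂ} (ht : t ∈ cutPlane) : DifferentiableAt ℂ tauOf t := by
  have h1 : DifferentiableAt ℂ (fun t => ellK (1 - t)) t :=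
    DifferentiableAt.comp (f := fun t => 1 - t) (g := ellK) t
      (differentiableAt_ellK (one_sub_mem_cutPlane ht).2) (by fun_prop)
  exact (h1.const_mul I).div (differentiableAt_ellK ht.2) (ellK_ne_zero ht)

/-! ### Inversion: `t = λ(τ(t))` -/

theorem modLambda_mem_cutPlane {s : ℝ} (hs : 1 / 2 < s) : modLambda (I * s) ∈ cutPlane := by
  obtain ⟨-, k, h0, h1, hk⟩ := ellK_modLambda_imag hs
  rw [hk]
  refine ⟨ofReal_mem_slitPlane.mpr h0, ?_⟩
  have : (1 - (k : ℂ)) = ((1 - k : ℝ) : ℂ) := by push_cast; rfl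
  rw [this]
  exact ofReal_mem_slitPlane.mpr (by linarith)

/-- Since 1 - λ(is) = λ(i/s), the evaluation of K is needed at s and at 1/s. Both exceed 1/2 exactly
when 1/2 < s < 2. -/
theorem tauOf_modLambda_imag {s : ℝ} (h1 : 1 / 2 < s) (h2 : s < 2) :
    tauOf (modLambda (I * s)) = I * s := by
  have hs : 0 < s := by linarith
  have hτ : 0 < (I * (s : ℂ)).im := by simpa using hs
  have hs0 : (s : ℂ) ≠ 0 := ofReal_ne_zero.mpr hs.ne'
  have hK := (ellK_modLambda_imag h1).1
  have hK0 := ellK_ne_zero (modLambda_mem_cutPlane h1)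
  have hinv : 1 / 2 < s⁻¹ := by
    rw [one_div]
    exact inv_strictAnti₀ hs h2
  have hK' := (ellK_modLambda_imag hinv).1
  have e : I * ((s⁻¹ : ℝ) : ℂ) = -1 / (I * s) := by
    push_cast
    field_simp
    rw [I_sq]
  rw [e, modLambda_S hτ, jacobiTheta₂_zero_S_sq hτ] at hK'
  rw [tauOf, div_eq_iff hK0, hK', hK]
  linear_combination (-I * s * Real.pi / 2 * jacobiTheta₂ 0 (I * s) ^ 2) * I_sq

/-- Because λ'(i) ≠ 0, the points λ(is) with s → 1, s ≠ 1, accumulate at λ(i) without eventually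
equalling it, so the identity theorem applies. -/
theorem eqOn_cutPlane {f g : ℂ → ℂ} (hf : DifferentiableOn ℂ f cutPlane)
    (hg : DifferentiableOn ℂ g cutPlane)
    (h : ∀ s : ℝ, 1 / 2 < s → s < 2 → f (modLambda (I * s)) = g (modLambda (I * s))) :
    Set.EqOn f g cutPlane := by
  have hone : (1 / 2 : ℝ) < 1 := by norm_num
  refine (hf.analyticOnNhd isOpen_cutPlane).eqOn_of_preconnected_of_frequently_eq
    (hg.analyticOnNhd isOpen_cutPlane) isPreconnected_cutPlane (modLambda_mem_cutPlane hone) ?_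
  have hτ : 0 < (I * ((1 : ℝ) : ℂ)).im := by simp
  obtain ⟨n2, n3, n4⟩ := theta_constants_ne_zero hτ
  have hpi : (Real.pi : ℂ) ≠ 0 := ofReal_ne_zero.mpr Real.pi_ne_zero
  have hd : HasDerivAt (fun s : ℂ => modLambda (I * s)) _ ((1 : ℝ) : ℂ) :=
    HasDerivAt.comp _ (hasDerivAt_modLambda hτ) ((hasDerivAt_id _).const_mul I)
  have ht := hd.comp_ofReal.tendsto_nhdsNE 
    (mul_ne_zero (div_ne_zero (mul_ne_zero (mul_ne_zero (mul_ne_zero I_ne_zero hpi)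
      (pow_ne_zero 4 n2)) (pow_ne_zero 4 n4)) (pow_ne_zero 4 n3)) (by simp))
  refine ht.frequently (Eventually.frequently ?_)
  have hm : Set.Ioo (1 / 2 : ℝ) 2 ∈ 𝓝 (1 : ℝ) := Ioo_mem_nhds (by norm_num) (by norm_num)
  filter_upwards [nhdsWithin_le_nhds hm] with s hs
  exact h s hs.1 hs.2

theorem modLambda_tauOf {t : ℂ} (ht : t ∈ cutPlane) : modLambda (tauOf t) = t := by
  refine eqOn_cutPlane (f := fun t => modLambda (tauOf t)) (g := id) (fun s hs => ?_)
    differentiableOn_id (fun s h1 h2 => ?_) ht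
  · exact (DifferentiableAt.comp s (hasDerivAt_modLambda (im_tauOf_pos hs)).differentiableAt
      (differentiableAt_tauOf hs)).differentiableWithinAt
  · simp only [tauOf_modLambda_imag h1 h2, id]

theorem hasDerivAt_tauOf {t : ℂ} (ht : t ∈ cutPlane) :
    HasDerivAt tauOf (jacobiTheta₂ 0 (tauOf t) ^ 4 / (I * Real.pi * thetaC 0 (tauOf t) ^ 4 *
      jacobiTheta₂ (1 / 2) (tauOf t) ^ 4)) t := by
  have hτ := im_tauOf_pos ht
  obtain ⟨n2, n3, n4⟩ := theta_constants_ne_zero hτ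
  have hpi : (Real.pi : ℂ) ≠ 0 := ofReal_ne_zero.mpr Real.pi_ne_zero
  have h1 := (differentiableAt_tauOf ht).hasDerivAt
  have h2 := (HasDerivAt.comp t (hasDerivAt_modLambda hτ) h1).unique
    ((hasDerivAt_id t).congr_of_eventuallyEq (by
      filter_upwards [isOpen_cutPlane.mem_nhds ht] with s hs
      exact modLambda_tauOf hs))
  have h3 : deriv tauOf t = jacobiTheta₂ 0 (tauOf t) ^ 4 / (I * Real.pi * thetaC 0 (tauOf t) ^ 4 *
      jacobiTheta₂ (1 / 2) (tauOf t) ^ 4) := by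
    rw [eq_div_iff (mul_ne_zero (mul_ne_zero (mul_ne_zero I_ne_zero hpi) (pow_ne_zero 4 n2))
      (pow_ne_zero 4 n4))]
    rw [div_mul_eq_mul_div, div_eq_iff (pow_ne_zero 4 n3)] at h2
    linear_combination h2
  rw [← h3]
  exact h1

/-! ### The theta functions in the normalised variable -/

theorem theta3_eq (v τ : ℂ) : theta3 v τ = jacobiTheta₂ (v / Real.pi) τ := rfl

theorem theta2_eq (v τ : ℂ) : theta2 v τ = thetaC (v / Real.pi) τ := by
  have hpi : (Real.pi : ℂ) ≠ 0 := ofReal_ne_zero.mpr Real.pi_ne_zero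
  rw [theta2, theta3, thetaC]
  congr 2 <;> field_simp

theorem theta4_eq (v τ : ℂ) : theta4 v τ = jacobiTheta₂ (v / Real.pi + 1 / 2) τ := rfl

theorem theta1_eq (v τ : ℂ) : theta1 v τ = -thetaC (v / Real.pi + 1 / 2) τ := by
  have hpi : (Real.pi : ℂ) ≠ 0 := ofReal_ne_zero.mpr Real.pi_ne_zero
  have e : I * Real.pi * τ / 4 + I * Real.pi * (v / Real.pi + 1 / 2) =
      (I * Real.pi * τ / 4 + I * v) + Real.pi / 2 * I := by
    field_simp
    ring
  rw [theta1, theta4, thetaC, e, exp_add _ (Real.pi / 2 * I), exp_pi_div_two_mul_I,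
    show (v + Real.pi * τ / 2) / Real.pi + 1 / 2 = v / Real.pi + 1 / 2 + τ / 2 by
      field_simp
      ring]
  ring

theorem picardQ_eq {x y t : ℂ} (ht : t ∈ cutPlane)
    (h4 : theta4 (x + tauOf t * y) (tauOf t) ≠ 0) :
    picardQ x y t = (thetaC 0 (tauOf t) * thetaC (x / Real.pi + y / Real.pi * tauOf t) (tauOf t) /
      (jacobiTheta₂ 0 (tauOf t) *
        jacobiTheta₂ (x / Real.pi + y / Real.pi * tauOf t) (tauOf t))) ^ 2 := by
  obtain ⟨n2, n3, n4⟩ := theta_constants_ne_zero (im_tauOf_pos ht)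
  have hpi : (Real.pi : ℂ) ≠ 0 := ofReal_ne_zero.mpr Real.pi_ne_zero
  have hK := ellK_ne_zero ht
  have hv : Real.pi * (2 * ellK t / Real.pi * (x + tauOf t * y)) / (2 * ellK t) =
      x + tauOf t * y := by
    field_simp
  have hz : (x + tauOf t * y) / Real.pi = x / Real.pi + y / Real.pi * tauOf t := by
    field_simp
  have ht' := modLambda_tauOf ht
  rw [picardQ, jacobiCn, jacobiDn, hv, theta2_eq, theta3_eq, hz]
  -- Only the explicit prefactor t is replaced by λ(τ(t)); the t inside τ(t) must stay.
  conv_lhs => enter [1, 1]; rw [← ht']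
  rw [sqrtK, sqrtK', modLambda, theta2_eq, theta3_eq, theta4_eq, zero_div, zero_add]
  generalize theta4 (x + tauOf t * y) (tauOf t) = T at h4 ⊢
  generalize jacobiTheta₂ (x / Real.pi + y / Real.pi * tauOf t) (tauOf t) = A
  generalize thetaC (x / Real.pi + y / Real.pi * tauOf t) (tauOf t) = C
  -- At a zero of θ₃ both sides are 0 by the convention for division by zero.
  by_cases hA : A = 0
  · simp [hA]
  · field_simp

/-! ### The algebraic identities behind the formula for `T₁` -/

theorem mul_tau_deriv {c a a₄ t dτ : ℂ} (hc : c ≠ 0) (ha : a ≠ 0) (ha₄ : a₄ ≠ 0)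
    (hquartic : a ^ 4 = c ^ 4 + a₄ ^ 4) (ht : t = c ^ 4 / a ^ 4)
    (hdτ : dτ = a ^ 4 / (I * Real.pi * c ^ 4 * a₄ ^ 4)) :
    t * (t - 1) * dτ = I / (Real.pi * a ^ 4) := by
  have hpi : (Real.pi : ℂ) ≠ 0 := ofReal_ne_zero.mpr Real.pi_ne_zero
  have e : t - 1 = -(a₄ ^ 4 / a ^ 4) := by
    rw [ht]
    field_simp
    linear_combination -hquartic
  rw [e, ht, hdτ]
  field_simp
  linear_combination -I_sq

/-- The numerator of the momentum. -/
theorem momentum_numerator {c a a₄ f M L η t q dτ : ℂ} (hc : c ≠ 0) (ha : a ≠ 0) (ha₄ : a₄ ≠ 0)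
    (hf : f ≠ 0) (hquartic : a ^ 4 = c ^ 4 + a₄ ^ 4) (ht : t = c ^ 4 / a ^ 4)
    (hq : q = (c * f / a) ^ 2) (hdτ : dτ = a ^ 4 / (I * Real.pi * c ^ 4 * a₄ ^ 4))
    (hM : M ^ 2 * f ^ 2 = Real.pi ^ 2 * (c ^ 2 - a ^ 2 * f ^ 2) * (a ^ 2 - c ^ 2 * f ^ 2)) :
    t * (t - 1) * (dτ * (q * (2 * η * M +
      (Real.pi ^ 2 * c ^ 2 * a ^ 2 * (c ^ 2 / a ^ 2 - a ^ 2 / c ^ 2)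
        + Real.pi ^ 2 * c ^ 2 * a ^ 2 * (f ^ 2 - 1 / f ^ 2) + M ^ 2 + 2 * M * L) /
        (2 * Real.pi * I)))) - q * (q - 1) =
      q * (I / (Real.pi * a ^ 4)) * M * (2 * η + L / (Real.pi * I)) := by
  have hpi : (Real.pi : ℂ) ≠ 0 := ofReal_ne_zero.mpr Real.pi_ne_zero
  have h1 := mul_tau_deriv hc ha ha₄ hquartic ht hdτ
  have h2 : M ^ 2 = Real.pi ^ 2 * (c ^ 2 - a ^ 2 * f ^ 2) * (a ^ 2 - c ^ 2 * f ^ 2) / f ^ 2 := by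
    rw [eq_div_iff (pow_ne_zero 2 hf), hM]
  -- Everything free of η and L collapses to a multiple of q - 1. After division by 2πi and
  -- multiplication by i/(πa⁴) it is exactly the q(q-1) subtracted on the left.
  have h3 : Real.pi ^ 2 * c ^ 2 * a ^ 2 * (c ^ 2 / a ^ 2 - a ^ 2 / c ^ 2)
      + Real.pi ^ 2 * c ^ 2 * a ^ 2 * (f ^ 2 - 1 / f ^ 2) + M ^ 2 =
      2 * Real.pi ^ 2 * a ^ 4 * (q - 1) := by
    rw [h2, hq]
    field_simp
    ring
  rw [h3]
  have h4 : t * (t - 1) * (dτ * (q * (2 * η * M +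
      (2 * Real.pi ^ 2 * a ^ 4 * (q - 1) + 2 * M * L) / (2 * Real.pi * I)))) =
      (t * (t - 1) * dτ) * q * (2 * η * M +
      (2 * Real.pi ^ 2 * a ^ 4 * (q - 1) + 2 * M * L) / (2 * Real.pi * I)) := by ring
  rw [h4, h1]
  field_simp
  ring

/-- The shifted parameters have κ₀ = κ₁ = θ - 1 = 0 and κ = -1/4, so only p² and a constant term
survive. The relation qM² = π²a⁴(q-1)(q-t) then cancels every factor of q(q-1)(q-t)p² except Y². -/
theorem hamiltonian_l3_momentum {c a f M Y t q q' : ℂ} (hc : c ≠ 0) (ha : a ≠ 0)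
    (hf : f ≠ 0) (ht : t = c ^ 4 / a ^ 4) (hq : q = (c * f / a) ^ 2)
    (ht0 : t ≠ 0) (ht1 : t ≠ 1) (hq1 : q ≠ 1) (hqt : q ≠ t)
    (hM : M ^ 2 * f ^ 2 = Real.pi ^ 2 * (c ^ 2 - a ^ 2 * f ^ 2) * (a ^ 2 - c ^ 2 * f ^ 2))
    (hq' : t * (t - 1) * q' - q * (q - 1) = q * (I / (Real.pi * a ^ 4)) * M * Y) :
    t * (t - 1) * hamiltonian Param.picard.l3 t q (momentum Param.picard t q q') =
      -Y ^ 2 / (4 * a ^ 4) - (q - t) / 4 := by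
  have hpi : (Real.pi : ℂ) ≠ 0 := ofReal_ne_zero.mpr Real.pi_ne_zero
  have h1 : q - 1 ≠ 0 := sub_ne_zero.mpr hq1
  have h2 : q - t ≠ 0 := sub_ne_zero.mpr hqt
  have h3 : t - 1 ≠ 0 := sub_ne_zero.mpr ht1
  have hq0 : q ≠ 0 := by
    rw [hq]
    positivity
  have h4 : (q - 1) * (q - t) * (Real.pi ^ 2 * a ^ 4) = q * M ^ 2 := by
    have h5 : M ^ 2 = Real.pi ^ 2 * (c ^ 2 - a ^ 2 * f ^ 2) * (a ^ 2 - c ^ 2 * f ^ 2) / f ^ 2 := by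
      rw [eq_div_iff (pow_ne_zero 2 hf), hM]
    rw [h5, hq, ht]
    field_simp
    ring
  have hp : momentum Param.picard t q q' = q * (I / (Real.pi * a ^ 4)) * M * Y /
      (2 * q * (q - 1) * (q - t)) := by
    rw [momentum, ← hq']
    congr 1
    simp only [Param.picard, Param.kappa0, Param.kappa1, Param.theta]
    ring
  have hH : ∀ p, t * (t - 1) * hamiltonian Param.picard.l3 t q p =
      q * (q - 1) * (q - t) * p ^ 2 - (q - t) / 4 := by
    intro p
    rw [hamiltonian, Param.l3_picard]
    simp only [Param.kappa, Param.kappa0, Param.kappa1, Param.kappaInf, Param.theta]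
    field_simp
    ring
  rw [hH, hp]
  congr 1
  field_simp
  rw [I_sq]
  linear_combination 4 * Y ^ 2 * h4

/-! ### Derivatives along `t` -/

theorem second_log_deriv_quotients {z τ : ℂ} (hτ : 0 < τ.im) (hC : thetaC z τ ≠ 0)
    (hA : jacobiTheta₂ z τ ≠ 0) :
    thetaDD z τ / jacobiTheta₂ z τ = thetaDD (1 / 2) τ / jacobiTheta₂ (1 / 2) τ +
        (jacobiTheta₂' z τ / jacobiTheta₂ z τ) ^ 2 -
          Real.pi ^ 2 * thetaC 0 τ ^ 2 * jacobiTheta₂ 0 τ ^ 2 *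
            (thetaC z τ / jacobiTheta₂ z τ) ^ 2 ∧
      thetaCDD z τ / thetaC z τ = thetaDD (1 / 2) τ / jacobiTheta₂ (1 / 2) τ +
        (thetaCD z τ / thetaC z τ) ^ 2 -
          Real.pi ^ 2 * thetaC 0 τ ^ 2 * jacobiTheta₂ 0 τ ^ 2 *
            (jacobiTheta₂ z τ / thetaC z τ) ^ 2 := by
  obtain ⟨h1, h2⟩ := second_log_deriv hτ z
  generalize thetaDD (1 / 2) τ / jacobiTheta₂ (1 / 2) τ = κ at *
  constructor
  · field_simp
    linear_combination h1
  · field_simp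
    linear_combination h2

/-- The `τ`-derivative of `(θ₂(0) θ₂(z) / (θ₃(0) θ₃(z)))²` along a line `z = ξ + η τ`. -/
theorem hasDerivAt_theta_quotient {ξ η τ : ℂ} (hτ : 0 < τ.im)
    (hC : thetaC (ξ + η * τ) τ ≠ 0) (hA : jacobiTheta₂ (ξ + η * τ) τ ≠ 0)
    {c a f L M : ℂ} (hc : thetaC 0 τ = c) (ha : jacobiTheta₂ 0 τ = a)
    (hf : f = thetaC (ξ + η * τ) τ / jacobiTheta₂ (ξ + η * τ) τ)
    (hL : L = jacobiTheta₂' (ξ + η * τ) τ / jacobiTheta₂ (ξ + η * τ) τ)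
    (hM : M = thetaCD (ξ + η * τ) τ / thetaC (ξ + η * τ) τ - L) :
    HasDerivAt (fun s => (thetaC 0 s * thetaC (ξ + η * s) s /
        (jacobiTheta₂ 0 s * jacobiTheta₂ (ξ + η * s) s)) ^ 2)
      ((c * f / a) ^ 2 * (2 * η * M + (Real.pi ^ 2 * c ^ 2 * a ^ 2 * (c ^ 2 / a ^ 2 - a ^ 2 / c ^ 2)
        + Real.pi ^ 2 * c ^ 2 * a ^ 2 * (f ^ 2 - 1 / f ^ 2) + M ^ 2 + 2 * M * L) /
          (2 * Real.pi * I))) τ := by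
  have hpi : (Real.pi : ℂ) ≠ 0 := ofReal_ne_zero.mpr Real.pi_ne_zero
  obtain ⟨n2, n3, -⟩ := theta_constants_ne_zero hτ
  have h := (((hasDerivAt_thetaC_snd hτ).mul (hasDerivAt_thetaC_line ξ η hτ)).div
    ((hasDerivAt_jacobiTheta₂_snd 0 hτ).mul (hasDerivAt_jacobiTheta₂_line ξ η hτ))
    (mul_ne_zero n3 hA)).pow 2
  refine h.congr_deriv ?_
  obtain ⟨s1, s2⟩ := second_log_deriv_quotients hτ hC hA
  obtain ⟨k1, k2⟩ := second_log_deriv_quotients hτ n2 n3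
  rw [jacobiTheta₂'_zero, zero_div] at k1
  rw [thetaCD_zero hτ, zero_div] at k2
  have hCD : thetaCD (ξ + η * τ) τ / thetaC (ξ + η * τ) τ = M + L := by rw [hM]; ring
  rw [← hf, ← hL] at s1
  have hfi : jacobiTheta₂ (ξ + η * τ) τ / thetaC (ξ + η * τ) τ = 1 / f := by
    rw [hf, one_div, inv_div]
  rw [hCD, hfi] at s2
  rw [div_eq_iff hC] at hCD
  rw [eq_comm, div_eq_iff hA] at hL
  rw [eq_comm, div_eq_iff hA] at hf
  rw [div_eq_iff hA] at s1
  rw [div_eq_iff hC] at s2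
  rw [div_eq_iff n3] at k1
  rw [div_eq_iff n2] at k2
  have hf0 : f ≠ 0 := by
    rintro rfl
    simp [hf] at hC
  -- The constant κ occurs twice with each sign in the logarithmic derivative and cancels, so its
  -- value plays no role.
  generalize thetaDD (1 / 2) τ / jacobiTheta₂ (1 / 2) τ = κ at *
  simp only [Pi.mul_apply, Pi.div_apply, s1, s2, k1, k2, hCD, hL]
  rw [hf] at *
  rw [hc, ha] at *
  generalize jacobiTheta₂ (ξ + η * τ) τ = A at *
  push_cast
  field_simp
  ring

/-- The function `q^{y²/π²} (1-t)^{1/4} θ₃(x+τy|τ) / θ₄(0|τ)`. -/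
def tauCandidate (x y t : ℂ) : ℂ :=
  nomePow t (y ^ 2 / (Real.pi : ℂ) ^ 2) * (1 - t) ^ (1 / 4 : ℂ) *
    (theta3 (x + tauOf t * y) (tauOf t) / theta4 0 (tauOf t))

theorem tauCandidate_ne_zero {x y t : ℂ} (ht : t ∈ regularSet x y) : tauCandidate x y t ≠ 0 := by
  obtain ⟨ht, -, -, h3, -⟩ := ht
  have n4 := (theta_constants_ne_zero (im_tauOf_pos ht)).2.2
  have h1 : (1 - t) ^ (1 / 4 : ℂ) ≠ 0 := by
    rw [Ne, cpow_eq_zero_iff, not_and_or]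
    exact Or.inl (slitPlane_ne_zero ht.2)
  refine mul_ne_zero (mul_ne_zero (exp_ne_zero _) h1) (div_ne_zero h3 ?_)
  rwa [theta4_eq, zero_div, zero_add]

/-- The logarithmic derivative of `tauCandidate`. -/
theorem hasDerivAt_tauCandidate {x y t dτ L : ℂ} (ht : t ∈ cutPlane)
    (hA : jacobiTheta₂ (x / Real.pi + y / Real.pi * tauOf t) (tauOf t) ≠ 0)
    (hdτ : HasDerivAt tauOf dτ t)
    (hL : L = jacobiTheta₂' (x / Real.pi + y / Real.pi * tauOf t) (tauOf t) /
      jacobiTheta₂ (x / Real.pi + y / Real.pi * tauOf t) (tauOf t)) :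
    HasDerivAt (tauCandidate x y)
      ((-1 / (4 * (1 - t)) + dτ * (I * Real.pi * (y / Real.pi) ^ 2 + y / Real.pi * L +
        (thetaDD (x / Real.pi + y / Real.pi * tauOf t) (tauOf t) /
          jacobiTheta₂ (x / Real.pi + y / Real.pi * tauOf t) (tauOf t) -
          thetaDD (1 / 2) (tauOf t) / jacobiTheta₂ (1 / 2) (tauOf t)) / (4 * Real.pi * I))) *
        tauCandidate x y t) t := by
  have hpi : (Real.pi : ℂ) ≠ 0 := ofReal_ne_zero.mpr Real.pi_ne_zero
  have hτ := im_tauOf_pos ht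
  have n4 := (theta_constants_ne_zero hτ).2.2
  have ht1 : 1 - t ≠ 0 := slitPlane_ne_zero ht.2
  have e : tauCandidate x y = fun s => exp (I * Real.pi * tauOf s * (y ^ 2 / Real.pi ^ 2)) *
      (1 - s) ^ (1 / 4 : ℂ) * (jacobiTheta₂ (x / Real.pi + y / Real.pi * tauOf s) (tauOf s) /
        jacobiTheta₂ (1 / 2) (tauOf s)) := by
    funext s
    rw [tauCandidate, nomePow, theta3_eq, theta4_eq, zero_div, zero_add,
      show (x + tauOf s * y) / Real.pi = x / Real.pi + y / Real.pi * tauOf s by field_simp]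
  have d1 := ((hdτ.const_mul (I * Real.pi)).mul_const (y ^ 2 / (Real.pi : ℂ) ^ 2)).cexp
  have d2 := ((hasDerivAt_id t).const_sub 1).cpow_const (c := (1 / 4 : ℂ)) ht.2
  have d3 : HasDerivAt (fun s => jacobiTheta₂ (x / Real.pi + y / Real.pi * tauOf s) (tauOf s)) _ t :=
    HasDerivAt.comp t (hasDerivAt_jacobiTheta₂_line (x / Real.pi) (y / Real.pi) hτ) hdτ
  have d4 : HasDerivAt (fun s => jacobiTheta₂ (1 / 2) (tauOf s)) _ t :=
    HasDerivAt.comp t (hasDerivAt_jacobiTheta₂_snd (1 / 2) hτ) hdτ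
  rw [e]
  refine ((d1.mul d2).mul (d3.div d4 n4)).congr_deriv ?_
  simp only [Pi.mul_apply, Pi.div_apply, id]
  rw [cpow_sub _ _ ht1, cpow_one]
  rw [eq_comm, div_eq_iff hA] at hL
  rw [hL]
  generalize jacobiTheta₂ (x / Real.pi + y / Real.pi * tauOf t) (tauOf t) = A at *
  generalize thetaDD (x / Real.pi + y / Real.pi * tauOf t) (tauOf t) = A''
  generalize exp (I * Real.pi * tauOf t * (y ^ 2 / Real.pi ^ 2)) = E
  generalize (1 - t) ^ (1 / 4 : ℂ) = R
  field_simp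
  ring

theorem H1_eq {x y t : ℂ} (ht0 : t ≠ 0) (ht1 : t ≠ 1) :
    H1 x y t = hamiltonian Param.picard.l3 t (picardQ x y t)
      (momentum Param.picard t (picardQ x y t) (deriv (picardQ x y) t)) := by
  rw [H1, h1, h0, H0, picardP, hamOfAux_auxShift _ _ _ _ ht0 ht1]

theorem hasDerivAt_tauCandidate_H1 {x y : ℂ} {U : Set ℂ} (hUo : IsOpen U)
    (hU : U ⊆ regularSet x y) {t : ℂ} (htU : t ∈ U) :
    HasDerivAt (tauCandidate x y) (H1 x y t * tauCandidate x y t) t := by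
  have hpi : (Real.pi : ℂ) ≠ 0 := ofReal_ne_zero.mpr Real.pi_ne_zero
  obtain ⟨ht, h1, h2, h3, h4⟩ := hU htU
  have hτ := im_tauOf_pos ht
  obtain ⟨n2, n3, n4⟩ := theta_constants_ne_zero hτ
  have ht0 : t ≠ 0 := slitPlane_ne_zero ht.1
  have ht1' : 1 - t ≠ 0 := slitPlane_ne_zero ht.2
  have ht1 : t ≠ 1 := fun h => ht1' (by rw [h, sub_self])
  have hz : (x + tauOf t * y) / Real.pi = x / Real.pi + y / Real.pi * tauOf t := by field_simp
  have hdτ := hasDerivAt_tauOf ht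
  have hlam := modLambda_tauOf ht
  have hquartic := theta_quartic hτ
  -- The derivative of `picardQ` enters H₁, so its theta expression is needed on a neighbourhood;
  -- openness of U provides one.
  have hQ : picardQ x y =ᶠ[𝓝 t] fun s => (thetaC 0 (tauOf s) *
      thetaC (x / Real.pi + y / Real.pi * tauOf s) (tauOf s) / (jacobiTheta₂ 0 (tauOf s) *
        jacobiTheta₂ (x / Real.pi + y / Real.pi * tauOf s) (tauOf s))) ^ 2 := by
    filter_upwards [hUo.mem_nhds htU] with s hs
    exact picardQ_eq (hU hs).1 (hU hs).2.2.2.2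
  rw [theta1_eq, hz, neg_ne_zero] at h1
  rw [theta2_eq, hz] at h2
  rw [theta3_eq, hz] at h3
  rw [theta4_eq, hz] at h4
  have i4 := jacobiTheta₂_add_half_sq_eq (x / Real.pi + y / Real.pi * tauOf t) hτ
  have i1 := thetaC_add_half_sq_eq (x / Real.pi + y / Real.pi * tauOf t) hτ
  have hW := wronskian_sq hτ (x / Real.pi + y / Real.pi * tauOf t)
  have s1 := (second_log_deriv_quotients hτ h2 h3).1
  obtain ⟨f, hf⟩ : ∃ f, f = thetaC (x / Real.pi + y / Real.pi * tauOf t) (tauOf t) /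
    jacobiTheta₂ (x / Real.pi + y / Real.pi * tauOf t) (tauOf t) := ⟨_, rfl⟩
  obtain ⟨L, hL⟩ : ∃ L, L = jacobiTheta₂' (x / Real.pi + y / Real.pi * tauOf t) (tauOf t) /
    jacobiTheta₂ (x / Real.pi + y / Real.pi * tauOf t) (tauOf t) := ⟨_, rfl⟩
  obtain ⟨M, hM⟩ : ∃ M, M = thetaCD (x / Real.pi + y / Real.pi * tauOf t) (tauOf t) /
    thetaC (x / Real.pi + y / Real.pi * tauOf t) (tauOf t) - L := ⟨_, rfl⟩
  have hf0 : f ≠ 0 := by rw [hf]; exact div_ne_zero h2 h3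
  have hq' := ((hasDerivAt_theta_quotient hτ h2 h3 rfl rfl hf hL hM).comp t hdτ).congr_of_eventuallyEq
    (f₁ := picardQ x y) hQ
  have hT := hasDerivAt_tauCandidate (x := x) (y := y) ht h3 hdτ hL
  refine hT.congr_deriv ?_
  congr 1
  rw [H1_eq ht0 ht1, (hq'.congr_deriv (mul_comm _ _)).deriv, hQ.eq_of_nhds]
  rw [← hf, ← hL] at s1
  rw [s1]
  have hqf : (thetaC 0 (tauOf t) * thetaC (x / Real.pi + y / Real.pi * tauOf t) (tauOf t) /
      (jacobiTheta₂ 0 (tauOf t) * jacobiTheta₂ (x / Real.pi + y / Real.pi * tauOf t) (tauOf t))) ^ 2 =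
      (thetaC 0 (tauOf t) * f / jacobiTheta₂ 0 (tauOf t)) ^ 2 := by
    rw [hf]
    congr 1
    field_simp
  rw [hqf]
  have hMM : M ^ 2 * f ^ 2 = Real.pi ^ 2 *
      (thetaC 0 (tauOf t) ^ 2 - jacobiTheta₂ 0 (tauOf t) ^ 2 * f ^ 2) *
      (jacobiTheta₂ 0 (tauOf t) ^ 2 - thetaC 0 (tauOf t) ^ 2 * f ^ 2) := by
    rw [hM, hL, hf]
    generalize x / Real.pi + y / Real.pi * tauOf t = z at h2 h3 hW ⊢
    field_simp
    linear_combination hW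
  have hC : thetaC (x / Real.pi + y / Real.pi * tauOf t) (tauOf t) =
      f * jacobiTheta₂ (x / Real.pi + y / Real.pi * tauOf t) (tauOf t) := by
    rw [hf, div_mul_cancel₀ _ h3]
  rw [hC] at i4 i1
  -- This factor and the next are proportional to θ₄² and θ₁² at πz; their non-vanishing is what q ≠
  -- 1 and q ≠ t amount to.
  have u4 : jacobiTheta₂ 0 (tauOf t) ^ 2 - thetaC 0 (tauOf t) ^ 2 * f ^ 2 ≠ 0 := by
    intro h
    refine mul_ne_zero (pow_ne_zero 2 n4) (pow_ne_zero 2 h4) ?_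
    rw [i4]
    linear_combination (jacobiTheta₂ (x / Real.pi + y / Real.pi * tauOf t) (tauOf t)) ^ 2 * h
  have u1 : thetaC 0 (tauOf t) ^ 2 - jacobiTheta₂ 0 (tauOf t) ^ 2 * f ^ 2 ≠ 0 := by
    intro h
    refine mul_ne_zero (pow_ne_zero 2 n4) (pow_ne_zero 2 h1) ?_
    rw [i1]
    linear_combination (jacobiTheta₂ (x / Real.pi + y / Real.pi * tauOf t) (tauOf t)) ^ 2 * h
  rw [modLambda] at hlam
  clear hT hq' hQ hqf hC i1 i4 hW s1 hL hM hf h1 h2 h3 h4 hz hdτ hU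
  generalize thetaDD (1 / 2) (tauOf t) / jacobiTheta₂ (1 / 2) (tauOf t) = κ
  generalize thetaC 0 (tauOf t) = c at *
  generalize jacobiTheta₂ 0 (tauOf t) = a at *
  generalize jacobiTheta₂ (1 / 2) (tauOf t) = a₄ at *
  have hq1 : (c * f / a) ^ 2 ≠ 1 := by
    intro h
    field_simp at h
    exact u4 (by linear_combination -h)
  have hqt : (c * f / a) ^ 2 ≠ t := by
    intro h
    rw [← hlam] at h
    field_simp at h
    exact u1 (by linear_combination -h)
  have key := hamiltonian_l3_momentum n2 n3 hf0 hlam.symm rfl ht0 ht1 hq1 hqt hMM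
    (momentum_numerator (η := y / Real.pi) (L := L) n2 n3 n4 hf0 hquartic hlam.symm rfl rfl hMM)
  have hts : t * (t - 1) ≠ 0 := mul_ne_zero ht0 (sub_ne_zero.mpr ht1)
  -- The comparison rests on iπη² + ηL + L²/(4πi) = (iπ/4)(2η + L/(πi))², which times i/(πa⁴) is
  -- -Y²/(4a⁴).
  refine mul_left_cancel₀ hts ?_
  rw [key, mul_add, ← mul_assoc (t * (t - 1)) _ (I * Real.pi * (y / Real.pi) ^ 2 + _ + _),
    mul_tau_deriv n2 n3 n4 hquartic hlam.symm rfl]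
  have e1 : t * (t - 1) * (-1 / (4 * (1 - t))) = t / 4 := by
    field_simp
    ring
  rw [e1]
  field_simp
  linear_combination (4 * L * I * y + 4 * y ^ 2 * I ^ 2 + L ^ 2) * I_sq

end

end PicardVI

theorem theorem2 (x y : ℂ) (U : Set ℂ) (hUo : IsOpen U) (hUc : IsPreconnected U)
    (hU : U ⊆ PicardVI.regularSet x y) (T : ℂ → ℂ) :
    PicardVI.IsTauFunction (PicardVI.H1 x y) U T ↔
      ∃ c : ℂ, c ≠ 0 ∧ ∀ t ∈ U,
        T t = c * PicardVI.nomePow t (y ^ 2 / (Real.pi : ℂ) ^ 2) * (1 - t) ^ (1 / 4 : ℂ) *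
          (PicardVI.theta3 (x + PicardVI.tauOf t * y) (PicardVI.tauOf t) /
            PicardVI.theta4 0 (PicardVI.tauOf t)) := by
  have hne := fun t (ht : t ∈ U) => PicardVI.tauCandidate_ne_zero (hU ht)
  have hder := fun t (ht : t ∈ U) => PicardVI.hasDerivAt_tauCandidate_H1 hUo hU ht
  have hform : ∀ c t : ℂ, c * PicardVI.nomePow t (y ^ 2 / (Real.pi : ℂ) ^ 2) *
      (1 - t) ^ (1 / 4 : ℂ) * (PicardVI.theta3 (x + PicardVI.tauOf t * y) (PicardVI.tauOf t) /
        PicardVI.theta4 0 (PicardVI.tauOf t)) = c * PicardVI.tauCandidate x y t := fun c t => by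
    rw [PicardVI.tauCandidate]
    ring
  simp only [hform]
  constructor
  · intro hT
    rcases U.eq_empty_or_nonempty with rfl | ⟨t₀, h₀⟩
    · exact ⟨1, one_ne_zero, fun t ht => absurd ht (Set.notMem_empty t)⟩
    -- Numerator and denominator solve the same linear equation T' = H₁T, so their quotient is
    -- constant on the preconnected set U.
    have hd : ∀ t ∈ U, HasDerivAt (fun s => T s / PicardVI.tauCandidate x y s) 0 t := by
      intro t ht
      refine ((hT t ht).2.div (hder t ht) (hne t ht)).congr_deriv ?_
      ring
    refine ⟨T t₀ / PicardVI.tauCandidate x y t₀, div_ne_zero (hT t₀ h₀).1 (hne t₀ h₀),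
      fun t ht => ?_⟩
    have := hUo.is_const_of_deriv_eq_zero hUc
      (fun s hs => (hd s hs).differentiableAt.differentiableWithinAt)
      (fun s hs => (hd s hs).deriv) ht h₀
    rw [← this, div_mul_cancel₀ _ (hne t ht)]
  · rintro ⟨c, hc, hT⟩ t ht
    rw [hT t ht]
    refine ⟨mul_ne_zero hc (hne t ht), ?_⟩
    refine (((hder t ht).const_mul c).congr_of_eventuallyEq ?_).congr_deriv (by ring)
    filter_upwards [hUo.mem_nhds ht] with s hs
    exact hT s hs
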